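/- Let $0<a<1$, let $b>1$ be an integer with $ab>1$, and let $(a_n)_{n\ge 0}$ be independent real random variables on a probability space, with $a_n$ uniformly distributed on $(-a^n,a^n)$. Then almost surely the series $$w(x)=\sum_{n=0}^{\infty} a_n\cos(2\pi b^n x)$$ converges for every $x\in\mathbb{R}$; almost surely the graph $\{(x,w(x)):x\in\mathbb{R}\}\subset\mathbb{R}^2$ has Hausdorff dimension $$2+\frac{\log a}{\log b};$$ and almost surely, for every period $T>0$ of $w$ (for instance $T=1$), the occupation measure $\mu(S)=\mathcal{L}(\{x\in[0,T]: w(x)\in S\})$ (where $S\subset\mathbb{R}$ is a Borel set and $\mathcal{L}$ is Lebesgue measure) is absolutely continuous with respect to Lebesgue measure on $\mathbb{R}$, with a density in $L^2(\mathbb{R})$. -/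

import Mathlib

open MeasureTheory ProbabilityTheory

noncomputable section

/-- The Weierstrass-type function `x ↦ ∑ₙ cₙ cos (2π bⁿ x)` with coefficient sequence `c`. -/
def weierstrassSeries (b : ℕ) (c : ℕ → ℝ) (x : ℝ) : ℝ :=
  ∑' n : ℕ, c n * Real.cos (2 * Real.pi * (b : ℝ) ^ n * x)

/-- The graph of `f : ℝ → ℝ`, as a subset of the Euclidean plane. -/
def planarGraph (f : ℝ → ℝ) : Set (EuclideanSpace ℝ (Fin 2)) :=
  Set.range fun x : ℝ => !₂[x, f x]

/-- The occupation measure of `f` over `[0, T]`: the image under `f` of Lebesgue measure on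
`[0, T]`, that is `S ↦ Leb {x ∈ [0, T] | f x ∈ S}`. -/
def occupationMeasure (f : ℝ → ℝ) (T : ℝ) : Measure ℝ :=
  (volume.restrict (Set.Icc 0 T)).map f

theorem occupationMeasure_apply {f : ℝ → ℝ} (hf : Measurable f) (T : ℝ) {S : Set ℝ}
    (hS : MeasurableSet S) :
    occupationMeasure f T S = volume {x ∈ Set.Icc 0 T | f x ∈ S} := by
  rw [occupationMeasure, Measure.map_apply hf hS, Measure.restrict_apply (hf hS), Set.inter_comm]
  rfl

/-- `μ` is absolutely continuous with respect to Lebesgue measure on `ℝ`, with a density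
in `L²(ℝ)`. -/
def HasL2Density (μ : Measure ℝ) : Prop :=
  ∃ ρ : ℝ → ℝ, (∀ t, 0 ≤ ρ t) ∧ MemLp ρ 2 volume ∧
    μ = volume.withDensity fun t => ENNReal.ofReal (ρ t)

end

/-! Write `a = b ^ (-α)` with `0 < α < 1`. Everything rests on the law of one increment. The
difference `w x - w y` is `∑ Aₙ qₙ`, where `qₙ = -2 sin (π bⁿ (x + y)) sin (π bⁿ (x - y))`. Freeze
all coefficients but `Aₙ`: by independence the increment has density at most `1 / (2 aⁿ |qₙ|)`. As
`n` is free, the infimum over `n`, which is `densityBound`, also bounds the density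
(`lintegral_increment_le`).

Occupation measure: the expected mean ball average at radius `r` is at most the double integral of
`densityBound`, whatever `r` is. That integral is finite (`lintegral_densityBound_lt_top`), so by
Fatou the liminf of the averages is almost surely finite, and differentiation of measures then gives
an `L²` density (`hasL2Density_of_liminf_lt_top`).

Dimension: the series is Hölder of every exponent below `α`, and covering by squares gives the upper
bound `2 - α`. For the lower bound, lift Lebesgue measure to the graph. For `1 < s < 2 - α` the
density bound makes its expected `s`-energy finite (`lintegral_increment_rpow_neg_le`), hence the
dimension is almost surely at least `s` (`le_dimH_of_energy_lt_top`).

The recurring obstacle is that `1 / |sin|` just fails to be integrable. It is overcome by a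
geometric mean with a second bound, which replaces it by a power below one. -/

open Filter Topology
open scoped ENNReal NNReal

/-! ### Integrals of periodic functions and of power singularities -/

/-- The integral of a `1`-periodic function over a period does not change under the substitution
`y ↦ k y + c`. -/
theorem lintegral_periodic_affine {g : ℝ → ℝ≥0∞} (hg : Function.Periodic g 1)
    (hm : Measurable g) {k : ℕ} (hk : k ≠ 0) (c t s : ℝ) :
    ∫⁻ y in Set.Ioc t (t + 1), g (k * y + c) = ∫⁻ u in Set.Ioc s (s + 1), g u := by
  set G : UnitAddCircle → ℝ≥0∞ := hg.lift with hG
  have hGg : ∀ y : ℝ, G (y : UnitAddCircle) = g y := fun y => hg.lift_coe y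
  have hGm : Measurable G := by
    have : G = fun z => g ((AddCircle.measurableEquivIoc 1 0 z : Set.Ioc (0 : ℝ) (0 + 1)) : ℝ) := by
      funext z
      rw [← hGg]
      congr 1
      exact ((AddCircle.measurableEquivIoc 1 0).symm_apply_apply z).symm
    rw [this]
    exact hm.comp (measurable_subtype_coe.comp (AddCircle.measurableEquivIoc 1 0).measurable)
  -- On the circle, multiplication by `k` and translation both preserve Haar measure, so no interval
  -- has to be cut into `k` pieces.
  have hmp : MeasurePreserving (fun z : UnitAddCircle => k • z + (c : UnitAddCircle))
      volume volume := by
    have h1 : MeasurePreserving (fun z : UnitAddCircle => k • z) volume volume := by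
      rcases Nat.lt_or_ge 1 k with h | h
      · exact (AddCircle.ergodic_nsmul h).toMeasurePreserving
      · obtain rfl : k = 1 := by omega
        simp only [one_smul]
        exact MeasurePreserving.id _
    exact (measurePreserving_add_right volume (c : UnitAddCircle)).comp h1
  calc ∫⁻ y in Set.Ioc t (t + 1), g (k * y + c)
      = ∫⁻ y in Set.Ioc t (t + 1), (fun z : UnitAddCircle => G (k • z + c)) (y : UnitAddCircle) := by
        refine lintegral_congr fun y => ?_
        have : (k • (y : UnitAddCircle) + (c : UnitAddCircle)) = ((k * y + c : ℝ) : UnitAddCircle) := by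
          rw [← AddCircle.coe_nsmul, ← AddCircle.coe_add, nsmul_eq_mul]
        simp only [this, hGg]
    _ = ∫⁻ z : UnitAddCircle, G (k • z + c) :=
        UnitAddCircle.lintegral_preimage t fun z => G (k • z + c)
    _ = ∫⁻ z : UnitAddCircle, G z := hmp.lintegral_comp hGm
    _ = ∫⁻ u in Set.Ioc s (s + 1), g u := by
        rw [← UnitAddCircle.lintegral_preimage s]
        exact lintegral_congr fun y => hGg y

theorem lintegral_rpow_neg_abs_lt_top {β : ℝ} (hβ1 : β < 1) (R : ℝ) :
    ∫⁻ u in Set.Ioc (-R) R, ENNReal.ofReal |u| ^ (-β) < ∞ := by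
  have key : ∫⁻ u in Set.Ioc 0 R, ENNReal.ofReal |u| ^ (-β) < ∞ := by
    rcases le_or_gt R 0 with hR | hR
    · simp [Set.Ioc_eq_empty_of_le hR]
    have h1 : IntervalIntegrable (fun x : ℝ => x ^ (-β)) volume 0 R :=
      intervalIntegral.intervalIntegrable_rpow' (by linarith)
    have h2 := ((intervalIntegrable_iff_integrableOn_Ioc_of_le hR.le).1 h1).lintegral_lt_top
    refine lt_of_eq_of_lt (setLIntegral_congr_fun measurableSet_Ioc fun u hu => ?_) h2
    rw [abs_of_pos hu.1, ENNReal.ofReal_rpow_of_pos hu.1]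
  have hneg : ∫⁻ u in Set.Ico (-R) 0, ENNReal.ofReal |u| ^ (-β) < ∞ := by
    have hmp : MeasurePreserving (fun x : ℝ => -x) volume volume := Measure.measurePreserving_neg _
    have := hmp.setLIntegral_comp_preimage_emb (Homeomorph.neg ℝ).measurableEmbedding
      (fun u => ENNReal.ofReal |u| ^ (-β)) (Set.Ico (-R) 0)
    rw [← this]
    simpa using key
  have hsub : Set.Ioc (-R) R ⊆ (Set.Ico (-R) 0 ∪ Set.Ioc 0 R) ∪ {0} := by
    intro u hu
    rcases lt_trichotomy u 0 with h | h | h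
    · exact Or.inl (Or.inl ⟨hu.1.le, h⟩)
    · exact Or.inr h
    · exact Or.inl (Or.inr ⟨h, hu.2⟩)
  refine (lintegral_mono_set hsub).trans_lt ((lintegral_union_le _ _ _).trans_lt ?_)
  refine ENNReal.add_lt_top.2 ⟨(lintegral_union_le _ _ _).trans_lt
    (ENNReal.add_lt_top.2 ⟨hneg, key⟩), ?_⟩
  rw [setLIntegral_measure_zero _ _ (by simp)]
  exact ENNReal.zero_lt_top

/-! ### General criteria: anti-concentration, energy, `L²` densities -/

/-- Anti-concentration: if the law of `X` has density at most `D` and `Y` is independent of `X`,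
then `q X + Y` has density at most `D / |q|`. -/
theorem lintegral_comp_mul_add_le {Ω : Type*} [MeasurableSpace Ω] {P : Measure Ω}
    [IsProbabilityMeasure P] {X Y : Ω → ℝ} (hX : Measurable X) (hY : Measurable Y)
    (hind : IndepFun X Y P) {D : ℝ≥0∞} (hlaw : P.map X ≤ D • volume) {q : ℝ} (hq : q ≠ 0)
    {φ : ℝ → ℝ≥0∞} (hφ : Measurable φ) :
    ∫⁻ ω, φ (q * X ω + Y ω) ∂P ≤ D * (ENNReal.ofReal |q|)⁻¹ * ∫⁻ t, φ t := by
  have h1 : ∫⁻ ω, φ (q * X ω + Y ω) ∂P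
      = ∫⁻ z, φ (q * z.1 + z.2) ∂(P.map fun ω => (X ω, Y ω)) := by
    rw [lintegral_map (by fun_prop) (by fun_prop)]
  rw [h1, (indepFun_iff_map_prod_eq_prod_map_map hX.aemeasurable hY.aemeasurable).1 hind]
  have := Measure.isProbabilityMeasure_map (μ := P) hX.aemeasurable
  have := Measure.isProbabilityMeasure_map (μ := P) hY.aemeasurable
  rw [lintegral_prod_symm _ (by fun_prop)]
  -- Conditioning on `Y = y` leaves an affine substitution in Lebesgue measure, with Jacobian `1 /
  -- |q|`.
  have h2 : ∀ y : ℝ, ∫⁻ x, φ (q * x + y) ∂(P.map X) ≤ D * (ENNReal.ofReal |q|)⁻¹ * ∫⁻ t, φ t := by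
    intro y
    refine (lintegral_mono' hlaw le_rfl).trans ?_
    rw [lintegral_smul_measure, smul_eq_mul, mul_assoc]
    refine mul_le_mul_right (le_of_eq ?_) _
    have h3 : ∫⁻ x, φ (q * x + y) = ∫⁻ x, (fun t => φ (t + y)) x ∂(volume.map fun x : ℝ => q * x) := by
      rw [lintegral_map (by fun_prop) (by fun_prop)]
    rw [h3, Real.map_volume_mul_left hq, lintegral_smul_measure, lintegral_add_right_eq_self,
      abs_inv, ENNReal.ofReal_inv_of_pos (abs_pos.2 hq), smul_eq_mul]
  refine (lintegral_mono h2).trans ?_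
  simp

/-- A set carrying a nonzero measure of finite `s`-energy has dimension at least `s`. -/
theorem le_dimH_of_energy_lt_top {X : Type*} [MetricSpace X] [MeasurableSpace X] [BorelSpace X]
    [SecondCountableTopology X]
    (μ : Measure X) [IsFiniteMeasure μ] (hμ : μ ≠ 0) {E : Set X} (hE : μ Eᶜ = 0) {s : ℝ≥0}
    (hen : ∫⁻ x, ∫⁻ y, edist x y ^ (-(s : ℝ)) ∂μ ∂μ < ∞) : (s : ℝ≥0∞) ≤ dimH E := by
  have hmeas : Measurable fun x => ∫⁻ y, edist x y ^ (-(s : ℝ)) ∂μ :=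
    Measurable.lintegral_prod_right' (f := fun p : X × X => edist p.1 p.2 ^ (-(s : ℝ)))
      (measurable_edist.pow_const _)
  have hfin : ∀ᵐ x ∂μ, ∫⁻ y, edist x y ^ (-(s : ℝ)) ∂μ < ∞ := ae_lt_top hmeas hen.ne
  -- The potential is finite almost everywhere, so it is at most `n` on a set of positive mass for
  -- some `n`. The mass distribution principle is applied to `μ` restricted there.
  set A : ℕ → Set X := fun n => {x | ∫⁻ y, edist x y ^ (-(s : ℝ)) ∂μ ≤ n} with hA
  have hAm : ∀ n, MeasurableSet (A n) := fun n => measurableSet_le hmeas measurable_const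
  obtain ⟨n, hn⟩ : ∃ n, μ (A n) ≠ 0 := by
    by_contra! h
    have h0 : μ (⋃ n, A n) = 0 := measure_iUnion_null h
    apply hμ
    rw [← Measure.measure_univ_eq_zero]
    refine measure_mono_null ?_ (measure_union_null h0 (ae_iff.1 hfin))
    intro x _
    by_cases hx : ∫⁻ y, edist x y ^ (-(s : ℝ)) ∂μ < ∞
    · obtain ⟨n, hn⟩ := ENNReal.exists_nat_gt hx.ne
      exact Or.inl (Set.mem_iUnion.2 ⟨n, hn.le⟩)
    · exact Or.inr hx
  -- If `S` meets `A n` at `x`, then `edist x y` is at most the diameter on `S`, so the potential at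
  -- `x` dominates `ediam S ^ (-s) * μ (S ∩ A n)`.
  have hball : ∀ S : Set X, μ.restrict (A n) S ≤ (n + 1) * Metric.ediam S ^ (s : ℝ) := by
    intro S
    rw [Measure.restrict_apply' (hAm n)]
    rcases (S ∩ A n).eq_empty_or_nonempty with h | ⟨x, hxS, hxA⟩
    · simp [h]
    have h1 : Metric.ediam S ^ (-(s : ℝ)) * μ (S ∩ A n) ≤ n := by
      calc Metric.ediam S ^ (-(s : ℝ)) * μ (S ∩ A n)
          = ∫⁻ y in S ∩ A n, Metric.ediam S ^ (-(s : ℝ)) ∂μ := by simp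
        _ ≤ ∫⁻ y in S ∩ A n, edist x y ^ (-(s : ℝ)) ∂μ := by
            refine setLIntegral_mono ?_ fun y hy => ?_
            · exact (measurable_edist_right.pow_const _)
            · rw [ENNReal.rpow_neg, ENNReal.rpow_neg]
              exact ENNReal.inv_le_inv.2
                (ENNReal.rpow_le_rpow (Metric.edist_le_ediam_of_mem hxS hy.1) s.2)
        _ ≤ ∫⁻ y, edist x y ^ (-(s : ℝ)) ∂μ := setLIntegral_le_lintegral _ _
        _ ≤ n := hxA
    by_cases htop : Metric.ediam S ^ (s : ℝ) = ∞
    · rw [htop, ENNReal.mul_top (by simp)]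
      exact le_top
    by_cases hzero : Metric.ediam S ^ (s : ℝ) = 0
    · rw [ENNReal.rpow_neg, hzero, ENNReal.inv_zero] at h1
      have : μ (S ∩ A n) = 0 := by
        by_contra hne
        rw [ENNReal.top_mul hne] at h1
        exact absurd h1 (by simp)
      simp [this]
    · rw [ENNReal.rpow_neg, mul_comm, ← div_eq_mul_inv,
        ENNReal.div_le_iff hzero htop] at h1
      exact h1.trans (mul_le_mul_left (by simp) _)
  have hle : ((n : ℝ≥0∞) + 1)⁻¹ • μ.restrict (A n) ≤ Measure.hausdorffMeasure (s : ℝ) := by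
    refine Measure.le_hausdorffMeasure _ _ 1 one_pos fun S _ => ?_
    rw [Measure.smul_apply, smul_eq_mul, mul_comm, ← div_eq_mul_inv,
      ENNReal.div_le_iff (by simp) (by simp), mul_comm]
    exact hball S
  refine le_dimH_of_hausdorffMeasure_ne_zero fun h0 => ?_
  have h1 := hle E
  rw [h0, Measure.smul_apply, smul_eq_mul, nonpos_iff_eq_zero, mul_eq_zero] at h1
  rcases h1 with h1 | h1
  · simp at h1
  · apply hn
    rw [Measure.restrict_apply' (hAm n)] at h1
    refine measure_mono_null (fun x hx => ?_) (measure_union_null h1 hE)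
    by_cases hxE : x ∈ E
    · exact Or.inl ⟨hxE, hx⟩
    · exact Or.inr hxE

/-- A finite measure on the line whose mean ball averages stay bounded along some sequence of
radii has a square-integrable density. -/
theorem hasL2Density_of_liminf_lt_top (μ : Measure ℝ) [IsFiniteMeasure μ] {r : ℕ → ℝ}
    (hr : Tendsto r atTop (𝓝[>] 0))
    (h : liminf (fun n => ∫⁻ x, μ (Metric.closedBall x (r n)) /
      volume (Metric.closedBall x (r n)) ∂μ) atTop < ∞) : HasL2Density μ := by
  have hballm : ∀ n, Measurable fun x => μ (Metric.closedBall x (r n)) := by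
    intro n
    have : ∀ x, μ (Metric.closedBall x (r n))
        = ∫⁻ y, Set.indicator {p : ℝ × ℝ | dist p.2 p.1 ≤ r n} (fun _ => (1 : ℝ≥0∞)) (x, y) ∂μ := by
      intro x
      rw [← lintegral_indicator_one Metric.isClosed_closedBall.measurableSet]
      rfl
    simp_rw [this]
    refine Measurable.lintegral_prod_right' (f := Set.indicator {p : ℝ × ℝ | dist p.2 p.1 ≤ r n}
      (fun _ => (1 : ℝ≥0∞))) ?_
    exact measurable_const.indicator
      (measurableSet_le (measurable_snd.dist measurable_fst) measurable_const)
  have hm : ∀ n, Measurable fun x => μ (Metric.closedBall x (r n)) /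
      volume (Metric.closedBall x (r n)) := by
    intro n
    simp only [Real.volume_closedBall]
    exact (hballm n).div_const _
  have hfat := (lintegral_liminf_le (μ := μ) (u := atTop) hm).trans_lt h
  have hae : ∀ᵐ x ∂μ, liminf (fun n => μ (Metric.closedBall x (r n)) /
      volume (Metric.closedBall x (r n))) atTop < ∞ :=
    ae_lt_top (.liminf hm) hfat.ne
  have hac : μ ≪ volume := by
    -- On a Lebesgue-null set the derivative of Lebesgue measure with respect to `μ` vanishes
    -- `μ`-a.e. The inverse ball ratios then tend to infinity, against the finite liminf.
    refine Measure.AbsolutelyContinuous.mk fun S hS hS0 => ?_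
    have h1 : ∫⁻ x in S, volume.rnDeriv μ x ∂μ = 0 :=
      le_antisymm ((Measure.setLIntegral_rnDeriv_le S).trans hS0.le) zero_le
    rw [lintegral_eq_zero_iff (Measure.measurable_rnDeriv _ _)] at h1
    have h2 : ∀ᵐ x ∂μ.restrict S, False := by
      filter_upwards [h1, ae_restrict_of_ae hae,
        ae_restrict_of_ae (Besicovitch.ae_tendsto_rnDeriv volume μ)] with x hx0 hx1 hx2
      have h3 := (hx2.comp hr).inv
      simp only [Pi.zero_apply] at hx0
      rw [hx0, ENNReal.inv_zero] at h3
      have h4 : Tendsto (fun n => μ (Metric.closedBall x (r n)) /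
          volume (Metric.closedBall x (r n))) atTop (𝓝 ∞) := by
        refine h3.congr' ?_
        filter_upwards [hr.eventually self_mem_nhdsWithin] with n hn
        simp only [Function.comp]
        rw [ENNReal.inv_div]
        · left; exact measure_ne_top _ _
        · right
          rw [Real.volume_closedBall]
          simpa using hn
      rw [h4.liminf_eq] at hx1
      exact lt_irrefl _ hx1
    rw [ae_iff] at h2
    simpa using h2
  -- The ball ratios converge to the density `ρ`, so the Fatou bound controls `∫ ρ ∂μ`, which is `∫
  -- ρ²`.
  have hρ : ∫⁻ x, μ.rnDeriv volume x ∂μ < ∞ := by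
    refine lt_of_eq_of_lt (lintegral_congr_ae ?_) hfat
    filter_upwards [hac.ae_le (Besicovitch.ae_tendsto_rnDeriv μ volume)] with x hx
    exact (hx.comp hr).liminf_eq.symm
  have hwd := Measure.withDensity_rnDeriv_eq μ volume hac
  refine ⟨fun x => (μ.rnDeriv volume x).toReal, fun _ => ENNReal.toReal_nonneg, ⟨?_, ?_⟩, ?_⟩
  · exact (Measure.measurable_rnDeriv _ _).ennreal_toReal.aestronglyMeasurable
  · rw [eLpNorm_lt_top_iff_lintegral_rpow_enorm_lt_top (by simp) (by simp)]
    refine lt_of_le_of_lt ?_ hρ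
    have hsq := lintegral_withDensity_eq_lintegral_mul volume
      (Measure.measurable_rnDeriv μ volume) (Measure.measurable_rnDeriv μ volume)
    rw [hwd] at hsq
    rw [hsq]
    refine lintegral_mono fun x => ?_
    simp only [ENNReal.toReal_ofNat, ENNReal.rpow_ofNat, Pi.mul_apply, sq]
    gcongr <;>
    · rw [Real.enorm_eq_ofReal ENNReal.toReal_nonneg]
      exact ENNReal.ofReal_toReal_le
  · nth_rw 1 [← hwd]
    refine withDensity_congr_ae ?_
    filter_upwards [Measure.rnDeriv_lt_top μ volume] with x hx
    rw [ENNReal.ofReal_toReal hx.ne]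

/-! ### Dimension of the graph of a Hölder function -/

theorem edist_euclideanPlane_le {p q : EuclideanSpace ℝ (Fin 2)} {δ : ℝ}
    (h0 : |p 0 - q 0| ≤ δ) (h1 : |p 1 - q 1| ≤ δ) : edist p q ≤ ENNReal.ofReal (2 * δ) := by
  rw [edist_dist]
  refine ENNReal.ofReal_le_ofReal ?_
  rw [EuclideanSpace.dist_eq, Fin.sum_univ_two, Real.dist_eq, Real.dist_eq]
  have hδ : 0 ≤ δ := (abs_nonneg _).trans h0
  refine Real.sqrt_le_iff.2 ⟨by linarith, ?_⟩
  nlinarith [abs_nonneg (p 0 - q 0), abs_nonneg (p 1 - q 1)]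

/-- Over each of `n + 1` columns of width `δ = 1 / (n + 1)` the graph stays within `C δ ^ β` of its
value at the left end, so `O(δ ^ (β - 1))` squares of side `δ` cover it there. In all, `O(δ ^ (β -
2))` sets of diameter at most `2 δ` give bounded sums of `(2 - β)`-th powers. -/
theorem hausdorffMeasure_graph_Ico_lt_top {f : ℝ → ℝ} {C β : ℝ} (hβ1 : β ≤ 1)
    (hf : ∀ x y, |f x - f y| ≤ C * |x - y| ^ β) (hβ0 : 0 ≤ β) (k : ℤ) :
    μH[2 - β] ((fun x : ℝ => (!₂[x, f x] : EuclideanSpace ℝ (Fin 2))) '' Set.Ico (k : ℝ) (k + 1))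
      < ∞ := by
  have hC : 0 ≤ C := by simpa using (abs_nonneg _).trans (hf 1 0)
  set δ : ℕ → ℝ := fun n => ((n : ℝ) + 1)⁻¹ with hδ
  have hδ0 : ∀ n, 0 < δ n := fun n => by positivity
  have hnδ : ∀ n : ℕ, ((n : ℝ) + 1) * δ n = 1 := fun n => mul_inv_cancel₀ (by positivity)
  -- `M n` counts the squares in a column of height `2 C δ ^ β`; `c n i`, below, is the bottom of
  -- column `i`.
  set M : ℕ → ℕ := fun n => ⌊2 * C * δ n ^ (β - 1)⌋₊ + 1 with hM
  set c : ℕ → ℕ → ℝ := fun n i => f (k + i * δ n) - C * δ n ^ β with hc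
  set t : (n : ℕ) → Fin (n + 1) × Fin (M n) → Set (EuclideanSpace ℝ (Fin 2)) := fun n i =>
    {p | p 0 ∈ Set.Icc (k + i.1 * δ n) (k + i.1 * δ n + δ n) ∧
      p 1 ∈ Set.Icc (c n i.1 + i.2 * δ n) (c n i.1 + i.2 * δ n + δ n)} with ht
  have hdiam : ∀ n i, Metric.ediam (t n i) ≤ ENNReal.ofReal (2 * δ n) := by
    intro n i
    refine Metric.ediam_le fun p hp q hq => ?_
    obtain ⟨⟨a1, a2⟩, a3, a4⟩ := hp
    obtain ⟨⟨b1, b2⟩, b3, b4⟩ := hq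
    exact edist_euclideanPlane_le (abs_le.2 ⟨by linarith, by linarith⟩)
      (abs_le.2 ⟨by linarith, by linarith⟩)
  have hfloor : ∀ (n : ℕ) (x : ℝ), 0 ≤ x → ⌊((n : ℝ) + 1) * x⌋₊ * δ n ≤ x ∧
      x ≤ ⌊((n : ℝ) + 1) * x⌋₊ * δ n + δ n := by
    intro n x hx
    have e1 := Nat.floor_le (a := ((n : ℝ) + 1) * x) (by positivity)
    have e2 := (Nat.lt_floor_add_one (((n : ℝ) + 1) * x)).le
    have e3 : x = ((n : ℝ) + 1) * x * δ n := by rw [mul_right_comm, hnδ, one_mul]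
    constructor
    · calc _ ≤ ((n : ℝ) + 1) * x * δ n := mul_le_mul_of_nonneg_right e1 (hδ0 n).le
        _ = x := e3.symm
    · calc x = ((n : ℝ) + 1) * x * δ n := e3
        _ ≤ _ := mul_le_mul_of_nonneg_right e2 (hδ0 n).le
        _ = _ := by ring
  have hcov : ∀ n, (fun x : ℝ => (!₂[x, f x] : EuclideanSpace ℝ (Fin 2))) ''
      Set.Ico (k : ℝ) (k + 1) ⊆ ⋃ i, t n i := by
    rintro n _ ⟨x, ⟨hx0, hx1⟩, rfl⟩
    obtain ⟨l1, l2⟩ := hfloor n (x - k) (by linarith)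
    have hi : ⌊((n : ℝ) + 1) * (x - k)⌋₊ < n + 1 := by
      rw [Nat.floor_lt (mul_nonneg (by positivity) (by linarith))]
      push_cast
      nlinarith [hδ0 n]
    set i := ⌊((n : ℝ) + 1) * (x - k)⌋₊ with hidef
    have hosc : |f x - f (k + i * δ n)| ≤ C * δ n ^ β := by
      refine (hf _ _).trans (mul_le_mul_of_nonneg_left ?_ hC)
      exact Real.rpow_le_rpow (abs_nonneg _) (abs_le.2 ⟨by linarith, by linarith⟩) hβ0
    rw [abs_le] at hosc
    have hy0 : 0 ≤ f x - c n i := by simp only [hc]; linarith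
    have hy1 : f x - c n i ≤ 2 * C * δ n ^ β := by simp only [hc]; linarith
    obtain ⟨m1, m2⟩ := hfloor n _ hy0
    have hj : ⌊((n : ℝ) + 1) * (f x - c n i)⌋₊ < M n := by
      rw [hM, Nat.lt_succ_iff]
      refine Nat.floor_le_floor ?_
      calc ((n : ℝ) + 1) * (f x - c n i) ≤ ((n : ℝ) + 1) * (2 * C * δ n ^ β) :=
            mul_le_mul_of_nonneg_left hy1 (by positivity)
        _ = 2 * C * δ n ^ (β - 1) := by
            rw [Real.rpow_sub_one (hδ0 n).ne', div_eq_mul_inv, hδ, inv_inv]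
            ring
    refine Set.mem_iUnion.2 ⟨(⟨i, hi⟩, ⟨_, hj⟩), ⟨?_, ?_⟩, ?_, ?_⟩ <;>
      simp <;> linarith
  have hlim : Tendsto (fun n => ENNReal.ofReal (2 * δ n)) atTop (𝓝 0) := by
    have h1 : Tendsto (fun n => 2 * δ n) atTop (𝓝 (2 * 0)) :=
      (tendsto_const_nhds (x := (2 : ℝ))).mul
        (by simpa [hδ, one_div] using tendsto_one_div_add_atTop_nhds_zero_nat (𝕜 := ℝ))
    have h2 := (ENNReal.continuous_ofReal.tendsto _).comp h1
    rwa [mul_zero, ENNReal.ofReal_zero] at h2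
  refine (Measure.hausdorffMeasure_le_liminf_sum (2 - β) _ _ hlim t
    (Eventually.of_forall fun n i => hdiam n i) (Eventually.of_forall hcov)).trans_lt ?_
  refine lt_of_le_of_lt ?_ (ENNReal.ofReal_lt_top (r := (2 * C + 1) * 2 ^ (2 - β)))
  refine liminf_le_of_le (by isBoundedDefault) fun b hb => ?_
  obtain ⟨n, hn⟩ := hb.exists
  refine hn.trans ?_
  calc ∑ i, Metric.ediam (t n i) ^ (2 - β)
      ≤ ∑ _i : Fin (n + 1) × Fin (M n), ENNReal.ofReal (2 * δ n) ^ (2 - β) :=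
        Finset.sum_le_sum fun i _ => ENNReal.rpow_le_rpow (hdiam n i) (by linarith)
    _ = ENNReal.ofReal (((n : ℝ) + 1) * M n * (2 * δ n) ^ (2 - β)) := by
        rw [Finset.sum_const, Finset.card_univ, Fintype.card_prod, Fintype.card_fin,
          Fintype.card_fin, nsmul_eq_mul, ENNReal.ofReal_rpow_of_nonneg
            (mul_nonneg two_pos.le (hδ0 n).le) (by linarith), ENNReal.ofReal_mul (by positivity)]
        congr 1
        rw [← ENNReal.ofReal_natCast]
        push_cast
        rfl
    _ ≤ ENNReal.ofReal ((2 * C + 1) * 2 ^ (2 - β)) := by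
        refine ENNReal.ofReal_le_ofReal ?_
        have hδ1 : δ n ≤ 1 := inv_le_one_of_one_le₀ (by linarith [n.cast_nonneg (α := ℝ)])
        have hp : 1 ≤ δ n ^ (β - 1) :=
          Real.one_le_rpow_of_pos_of_le_one_of_nonpos (hδ0 n) hδ1 (by linarith)
        have hMle : (M n : ℝ) ≤ (2 * C + 1) * δ n ^ (β - 1) := by
          have := Nat.floor_le (a := 2 * C * δ n ^ (β - 1)) (by positivity)
          simp only [hM]
          push_cast
          linarith
        have e1 : (2 * δ n) ^ (2 - β) = 2 ^ (2 - β) * (δ n * δ n ^ (1 - β)) := by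
          rw [Real.mul_rpow two_pos.le (hδ0 n).le]
          congr 1
          rw [← Real.rpow_one_add' (hδ0 n).le (by linarith)]
          ring_nf
        have e2 : δ n ^ (β - 1) * δ n ^ (1 - β) = 1 := by
          rw [← Real.rpow_add (hδ0 n)]
          simp
        calc ((n : ℝ) + 1) * M n * (2 * δ n) ^ (2 - β)
            ≤ ((n : ℝ) + 1) * ((2 * C + 1) * δ n ^ (β - 1)) * (2 * δ n) ^ (2 - β) := by
              gcongr
          _ = (2 * C + 1) * 2 ^ (2 - β) * (((n : ℝ) + 1) * δ n) * (δ n ^ (β - 1) * δ n ^ (1 - β)) := by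
              rw [e1]; ring
          _ = (2 * C + 1) * 2 ^ (2 - β) := by rw [e2, hnδ, mul_one, mul_one]

theorem dimH_planarGraph_le {f : ℝ → ℝ} {C β : ℝ} (hβ0 : 0 ≤ β) (hβ1 : β ≤ 1)
    (hf : ∀ x y, |f x - f y| ≤ C * |x - y| ^ β) :
    dimH (planarGraph f) ≤ ENNReal.ofReal (2 - β) := by
  have hU : planarGraph f = ⋃ k : ℤ,
      (fun x : ℝ => (!₂[x, f x] : EuclideanSpace ℝ (Fin 2))) '' Set.Ico (k : ℝ) (k + 1) := by
    rw [planarGraph, ← Set.image_iUnion, iUnion_Ico_intCast, Set.image_univ]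
  rw [hU, dimH_iUnion]
  refine iSup_le fun k => ?_
  refine dimH_le_of_hausdorffMeasure_ne_top (d := (2 - β).toNNReal) ?_
  rw [Real.coe_toNNReal _ (by linarith)]
  exact (hausdorffMeasure_graph_Ico_lt_top hβ1 hf hβ0 k).ne

/-! ### The density bound and its integrability -/

/-- `1 / |sin (π u)|`, with value `∞` at the integers. -/
noncomputable def recipSin (u : ℝ) : ℝ≥0∞ := (ENNReal.ofReal |Real.sin (Real.pi * u)|)⁻¹

theorem measurable_recipSin : Measurable recipSin := by
  unfold recipSin
  fun_prop

theorem recipSin_add_nat (u : ℝ) (k : ℕ) : recipSin (u + k) = recipSin u := by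
  rw [recipSin, recipSin, mul_add, mul_comm Real.pi (k : ℝ), Real.sin_add_nat_mul_pi, abs_mul,
    abs_pow, abs_neg, abs_one, one_pow, one_mul]

theorem recipSin_neg (u : ℝ) : recipSin (-u) = recipSin u := by
  rw [recipSin, recipSin, mul_neg, Real.sin_neg, abs_neg]

theorem recipSin_ne_zero (u : ℝ) : recipSin u ≠ 0 := by simp [recipSin]

theorem recipSin_le {u : ℝ} (hu : |u| ≤ 1 / 2) : recipSin u ≤ (ENNReal.ofReal (2 * |u|))⁻¹ := by
  refine ENNReal.inv_le_inv.2 (ENNReal.ofReal_le_ofReal ?_)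
  have hpi := Real.pi_pos
  have h := Real.mul_abs_le_abs_sin (x := Real.pi * u)
    (by rw [abs_mul, abs_of_pos hpi]; nlinarith)
  rw [abs_mul, abs_of_pos hpi] at h
  refine le_trans (le_of_eq ?_) h
  field_simp

/-- At `β = 1` the singularity `1 / |u|` is no longer integrable; hence `recipSin` must be brought
to a power below one before it is integrated. -/
theorem lintegral_recipSin_rpow_lt_top {β : ℝ} (hβ0 : 0 ≤ β) (hβ1 : β < 1) :
    ∫⁻ u in Set.Ioc (-(1 / 2)) (1 / 2), recipSin u ^ β < ∞ := by
  refine lt_of_le_of_lt ?_ (lintegral_rpow_neg_abs_lt_top hβ1 (1 / 2))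
  refine setLIntegral_mono (by fun_prop) fun u hu => ?_
  rw [ENNReal.rpow_neg, ← ENNReal.inv_rpow]
  refine ENNReal.rpow_le_rpow ((recipSin_le (abs_le.2 ⟨hu.1.le, hu.2⟩)).trans ?_) hβ0
  refine ENNReal.inv_le_inv.2 (ENNReal.ofReal_le_ofReal ?_)
  linarith [abs_nonneg u]

/-- The value does not depend on `k` or `c`. A frequency `b ^ scaleIndex b v` that varies with
another variable therefore disappears after integration. -/
theorem lintegral_recipSin_affine {k : ℕ} (hk : k ≠ 0) (c t : ℝ) (β : ℝ) :
    ∫⁻ x in Set.Ioc t (t + 1), recipSin (k * x + c) ^ β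
      = ∫⁻ u in Set.Ioc (-(1 / 2)) (1 / 2), recipSin u ^ β := by
  have := lintegral_periodic_affine (g := fun u => recipSin u ^ β)
    (fun u => by simpa using congrArg (· ^ β) (recipSin_add_nat u 1))
    (measurable_recipSin.pow_const _) hk c t (-(1 / 2))
  rw [this]
  norm_num

/-- A bound for the density of the law of `w (x) - w (y)`, in terms of `u = x + y` and
`h = x - y`. -/
noncomputable def densityBound (a : ℝ) (b : ℕ) (u h : ℝ) : ℝ≥0∞ :=
  ⨅ n : ℕ, (ENNReal.ofReal (4 * a ^ n))⁻¹ * recipSin ((b : ℝ) ^ n * u) * recipSin ((b : ℝ) ^ n * h)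

section densityBound

variable {a : ℝ} {b : ℕ}

theorem densityBound_comm (u h : ℝ) : densityBound a b u h = densityBound a b h u := by
  unfold densityBound
  simp_rw [mul_right_comm]

@[fun_prop]
theorem Measurable.densityBound {X : Type*} [MeasurableSpace X] {f g : X → ℝ}
    (hf : Measurable f) (hg : Measurable g) : Measurable fun x => densityBound a b (f x) (g x) := by
  unfold _root_.densityBound
  exact .iInf fun n => (measurable_const.mul (measurable_recipSin.comp (hf.const_mul _))).mul
    (measurable_recipSin.comp (hg.const_mul _))

theorem densityBound_add_one_left (u h : ℝ) :
    densityBound a b (u + 1) h = densityBound a b u h := by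
  have : ∀ n : ℕ, recipSin ((b : ℝ) ^ n * (u + 1)) = recipSin ((b : ℝ) ^ n * u) := fun n => by
    have := recipSin_add_nat ((b : ℝ) ^ n * u) (b ^ n)
    push_cast at this
    rw [← this]
    ring_nf
  simp only [densityBound, this]

theorem densityBound_add_one_right (u h : ℝ) :
    densityBound a b u (h + 1) = densityBound a b u h := by
  rw [densityBound_comm, densityBound_add_one_left, densityBound_comm]

theorem densityBound_neg_right (u h : ℝ) : densityBound a b u (-h) = densityBound a b u h := by
  simp only [densityBound, mul_neg, recipSin_neg]

/-- The largest `j` with `bʲ |v| ≤ 1 / 2`, when `0 < |v| ≤ 1 / 2`. -/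
noncomputable def scaleIndex (b : ℕ) (v : ℝ) : ℕ := Nat.log b ⌊(2 * |v|)⁻¹⌋₊

theorem measurable_scaleIndex : Measurable (scaleIndex b) := by
  unfold scaleIndex
  exact (measurable_from_nat (f := Nat.log b)).comp
    (Nat.measurable_floor.comp (by fun_prop))

theorem scaleIndex_spec (hb : 1 < b) {v : ℝ} (hv : v ≠ 0) (hv1 : |v| ≤ 1 / 2) :
    (b : ℝ) ^ scaleIndex b v * |v| ≤ 1 / 2 ∧ 1 / 2 ≤ (b : ℝ) * ((b : ℝ) ^ scaleIndex b v * |v|) := by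
  have hv0 : 0 < |v| := abs_pos.2 hv
  have h1 : 1 ≤ (2 * |v|)⁻¹ := (one_le_inv₀ (by positivity)).2 (by linarith)
  have hm : ⌊(2 * |v|)⁻¹⌋₊ ≠ 0 := (Nat.floor_pos.2 h1).ne'
  have h2 : ((b ^ scaleIndex b v : ℕ) : ℝ) ≤ (2 * |v|)⁻¹ :=
    (Nat.cast_le.2 (Nat.pow_log_le_self b hm)).trans (Nat.floor_le (by positivity))
  have h3 : (2 * |v|)⁻¹ ≤ ((b ^ (scaleIndex b v + 1) : ℕ) : ℝ) :=
    (Nat.lt_floor_add_one _).le.trans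
      (by exact_mod_cast Nat.lt_pow_succ_log_self hb ⌊(2 * |v|)⁻¹⌋₊)
  push_cast at h2 h3
  have e : (2 * |v|)⁻¹ * |v| = 1 / 2 := by field_simp
  constructor
  · calc _ ≤ (2 * |v|)⁻¹ * |v| := mul_le_mul_of_nonneg_right h2 hv0.le
      _ = _ := e
  · calc (1 : ℝ) / 2 = (2 * |v|)⁻¹ * |v| := e.symm
      _ ≤ _ := mul_le_mul_of_nonneg_right h3 hv0.le
      _ = _ := by ring

/-- At this scale `bʲ |v|` lies in `[1 / (2 b), 1 / 2]`, where Jordan's inequality gives `|sin| ≥ 1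
/ b`. -/
theorem recipSin_scaleIndex_le (hb : 1 < b) {v : ℝ} (hv : v ≠ 0) (hv1 : |v| ≤ 1 / 2) :
    recipSin ((b : ℝ) ^ scaleIndex b v * v) ≤ b := by
  obtain ⟨h1, h2⟩ := scaleIndex_spec hb hv hv1
  have hb0 : (0 : ℝ) < b := by positivity
  have e : |(b : ℝ) ^ scaleIndex b v * v| = (b : ℝ) ^ scaleIndex b v * |v| := by
    rw [abs_mul, abs_of_pos (by positivity)]
  refine (recipSin_le (e ▸ h1)).trans ?_
  rw [e, ENNReal.inv_le_iff_inv_le, ← ENNReal.ofReal_natCast, ← ENNReal.ofReal_inv_of_pos hb0]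
  refine ENNReal.ofReal_le_ofReal ((inv_le_iff_one_le_mul₀' hb0).2 (by linarith))

variable {α : ℝ}

/-- Take the term of the infimum at the scale `j` of `h`: its factor in `h` is at most `b`, and `bʲ
|h| ≤ 1 / 2` gives `aʲ = (bʲ) ^ (-α) ≥ |h| ^ α`. -/
theorem densityBound_le_left (hb : 1 < b) (hα0 : 0 < α) (ha : (b : ℝ) ^ (-α) = a) (u : ℝ) {h : ℝ}
    (hh : |h| ≤ 1 / 2) : densityBound a b u h ≤
      b * ENNReal.ofReal |h| ^ (-α) * recipSin ((b : ℝ) ^ scaleIndex b h * u) := by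
  have hb0 : (0 : ℝ) < b := by positivity
  -- At `h = 0` the right side is `∞`, since `0 ^ (-α) = ∞` and `recipSin` never vanishes.
  rcases eq_or_ne h 0 with rfl | h0
  · rw [abs_zero, ENNReal.ofReal_zero, ENNReal.zero_rpow_of_neg (by linarith),
      ENNReal.mul_top (by positivity), ENNReal.top_mul (recipSin_ne_zero _)]
    exact le_top
  have hpos : 0 < |h| := abs_pos.2 h0
  obtain ⟨h1, -⟩ := scaleIndex_spec hb h0 hh
  have ha0 : 0 < a := ha ▸ Real.rpow_pos_of_pos hb0 _
  have key : (ENNReal.ofReal (4 * a ^ scaleIndex b h))⁻¹ ≤ ENNReal.ofReal |h| ^ (-α) := by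
    rw [ENNReal.rpow_neg, ENNReal.ofReal_rpow_of_pos hpos]
    refine ENNReal.inv_le_inv.2 (ENNReal.ofReal_le_ofReal ?_)
    have e : a ^ scaleIndex b h = ((b : ℝ) ^ scaleIndex b h) ^ (-α) := by
      rw [← ha, ← Real.rpow_natCast, ← Real.rpow_natCast, ← Real.rpow_mul hb0.le,
        ← Real.rpow_mul hb0.le, mul_comm]
    have h2 : |h| ≤ ((b : ℝ) ^ scaleIndex b h)⁻¹ := by
      rw [← one_div, le_div_iff₀ (by positivity)]
      linarith
    calc |h| ^ α ≤ (((b : ℝ) ^ scaleIndex b h)⁻¹) ^ α := Real.rpow_le_rpow hpos.le h2 hα0.le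
      _ = a ^ scaleIndex b h := by
        rw [e, Real.rpow_neg (by positivity), Real.inv_rpow (by positivity)]
      _ ≤ 4 * a ^ scaleIndex b h := by linarith [pow_pos ha0 (scaleIndex b h)]
  refine (iInf_le _ (scaleIndex b h)).trans ?_
  calc _ ≤ ENNReal.ofReal |h| ^ (-α) * recipSin ((b : ℝ) ^ scaleIndex b h * u) * b :=
        mul_le_mul' (mul_le_mul' key le_rfl) (recipSin_scaleIndex_le hb h0 hh)
    _ = _ := by ring

/-- Take the term at the scale `i` of the larger variable `g`. Then `bⁱ |v| ≤ 1 / 2` too, and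
Jordan's inequality leaves `1 / ((a b)ⁱ |v|)` up to a constant. This is where `a b > 1` enters. -/
theorem densityBound_le_inv (hb : 1 < b) (ha0 : 0 < a) (hab : 1 < a * b) {v g : ℝ}
    (hvg : |v| ≤ |g|) (hg : |g| ≤ 1 / 2) :
    densityBound a b v g ≤ b * ENNReal.ofReal |v| ^ (-1 : ℝ) := by
  have hb0 : (0 : ℝ) < b := by positivity
  rcases eq_or_ne v 0 with rfl | hv0
  · rw [abs_zero, ENNReal.ofReal_zero, ENNReal.zero_rpow_of_neg (by linarith),
      ENNReal.mul_top (by positivity)]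
    exact le_top
  have hpos : 0 < |v| := abs_pos.2 hv0
  have hg0 : g ≠ 0 := abs_pos.1 (hpos.trans_le hvg)
  obtain ⟨h1, -⟩ := scaleIndex_spec hb hg0 hg
  set i := scaleIndex b g
  have e : |(b : ℝ) ^ i * v| = (b : ℝ) ^ i * |v| := by
    rw [abs_mul, abs_of_pos (by positivity)]
  have h2 : (b : ℝ) ^ i * |v| ≤ 1 / 2 := (mul_le_mul_of_nonneg_left hvg (by positivity)).trans h1
  have h3 := recipSin_le (u := (b : ℝ) ^ i * v) (e ▸ h2)
  refine (iInf_le _ i).trans ?_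
  calc _ ≤ (ENNReal.ofReal (4 * a ^ i))⁻¹ * (ENNReal.ofReal (2 * |(b : ℝ) ^ i * v|))⁻¹ * b :=
        mul_le_mul' (mul_le_mul' le_rfl h3) (recipSin_scaleIndex_le hb hg0 hg)
    _ ≤ ENNReal.ofReal |v| ^ (-1 : ℝ) * b := by
        refine mul_le_mul' ?_ le_rfl
        rw [ENNReal.rpow_neg_one, ← ENNReal.mul_inv (.inr ENNReal.ofReal_ne_top) (.inl ENNReal.ofReal_ne_top),
          ← ENNReal.ofReal_mul (by positivity), e]
        refine ENNReal.inv_le_inv.2 (ENNReal.ofReal_le_ofReal ?_)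
        have : 1 ≤ (a * b) ^ i := one_le_pow₀ hab.le
        calc |v| ≤ (a * b) ^ i * |v| := le_mul_of_one_le_left hpos.le this
          _ ≤ 8 * ((a * b) ^ i * |v|) := by
            have : 0 ≤ (a * b) ^ i * |v| := by positivity
            linarith
          _ = _ := by rw [mul_pow]; ring
    _ = _ := mul_comm _ _

theorem ENNReal.le_rpow_mul_rpow {x y z : ℝ≥0∞} {θ : ℝ} (h0 : 0 ≤ θ) (h1 : θ ≤ 1) (hx : z ≤ x)
    (hy : z ≤ y) : z ≤ x ^ θ * y ^ (1 - θ) := by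
  calc z = z ^ θ * z ^ (1 - θ) := by
        rw [← ENNReal.rpow_add_of_nonneg _ _ h0 (by linarith)]
        simp
    _ ≤ _ := mul_le_mul' (ENNReal.rpow_le_rpow hx h0) (ENNReal.rpow_le_rpow hy (by linarith))

/-- The majorant of `densityBound` on `|v| ≤ |g|`. -/
noncomputable def densityMajorant (b : ℕ) (α v g : ℝ) : ℝ≥0∞ :=
  b * ENNReal.ofReal |v| ^ (-((1 + α) / 2)) * recipSin ((b : ℝ) ^ scaleIndex b v * g) ^ (1 / 2 : ℝ)

/-- One bound contains `recipSin`, the other `|v|⁻¹`, and neither is integrable. Their geometric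
mean has exponents `1 / 2` and `(1 + α) / 2`, both below one when `α < 1`. -/
theorem densityBound_le_majorant (hb : 1 < b) (hα0 : 0 < α) (ha : (b : ℝ) ^ (-α) = a)
    (hab : 1 < a * b) {v g : ℝ} (hvg : |v| ≤ |g|) (hg : |g| ≤ 1 / 2) :
    densityBound a b v g ≤ densityMajorant b α v g := by
  have hb0 : (0 : ℝ) < b := by positivity
  have ha0 : 0 < a := ha ▸ Real.rpow_pos_of_pos hb0 _
  have h1 := densityBound_le_inv hb ha0 hab hvg hg
  have h2 := densityBound_le_left hb hα0 ha g (hvg.trans hg)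
  rw [densityBound_comm] at h2
  refine (ENNReal.le_rpow_mul_rpow (θ := 1 / 2) (by norm_num) (by norm_num) h2 h1).trans
    (le_of_eq ?_)
  rcases eq_or_ne v 0 with rfl | hv0
  · rw [densityMajorant, abs_zero, ENNReal.ofReal_zero, ENNReal.zero_rpow_of_neg (by linarith),
      ENNReal.zero_rpow_of_neg (by linarith), ENNReal.zero_rpow_of_neg (by linarith)]
    have hb' : (b : ℝ≥0∞) ≠ 0 := by positivity
    have : recipSin ((b : ℝ) ^ scaleIndex b 0 * g) ^ (1 / 2 : ℝ) ≠ 0 := by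
      simp [recipSin_ne_zero]
    rw [ENNReal.mul_top hb', ENNReal.top_mul (recipSin_ne_zero _), ENNReal.top_mul this,
      ENNReal.top_rpow_of_pos (by norm_num), ENNReal.top_rpow_of_pos (by norm_num),
      ENNReal.top_mul_top]
  · have hpos : ENNReal.ofReal |v| ≠ 0 := by simpa using hv0
    rw [densityMajorant, ENNReal.mul_rpow_of_nonneg _ _ (by norm_num),
      ENNReal.mul_rpow_of_nonneg _ _ (by norm_num), ENNReal.mul_rpow_of_nonneg _ _ (by norm_num),
      ← ENNReal.rpow_mul, ← ENNReal.rpow_mul]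
    have e1 : (b : ℝ≥0∞) ^ (1 / 2 : ℝ) * (b : ℝ≥0∞) ^ (1 - 1 / 2 : ℝ) = b := by
      rw [← ENNReal.rpow_add_of_nonneg _ _ (by norm_num) (by norm_num)]
      norm_num
    have e2 : ENNReal.ofReal |v| ^ (-α * (1 / 2)) * ENNReal.ofReal |v| ^ (-1 * (1 - 1 / 2) : ℝ)
        = ENNReal.ofReal |v| ^ (-((1 + α) / 2)) := by
      rw [← ENNReal.rpow_add _ _ hpos ENNReal.ofReal_ne_top]
      congr 1
      ring
    rw [← e2]
    nth_rw 3 [← e1]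
    ring

@[fun_prop]
theorem Measurable.densityMajorant {X : Type*} [MeasurableSpace X] {f g : X → ℝ}
    (hf : Measurable f) (hg : Measurable g) :
    Measurable fun x => densityMajorant b α (f x) (g x) := by
  unfold _root_.densityMajorant
  have h1 := measurable_recipSin
  have h2 : Measurable fun x => (b : ℝ) ^ scaleIndex b (f x) :=
    (measurable_from_nat (f := fun n => (b : ℝ) ^ n)).comp (measurable_scaleIndex.comp hf)
  fun_prop

theorem lintegral_densityMajorant_lt_top (hb : 1 < b) (hα1 : α < 1) :
    ∫⁻ v in Set.Ioc (-(1 / 2)) (1 / 2), ∫⁻ g in Set.Ioc (-(1 / 2)) (1 / 2),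
      densityMajorant b α v g < ∞ := by
  set J := ∫⁻ u in Set.Ioc (-(1 / 2)) (1 / 2), recipSin u ^ (1 / 2 : ℝ) with hJ
  have hJt : J < ∞ := lintegral_recipSin_rpow_lt_top (by norm_num) (by norm_num)
  have h1 : ∀ v, ∫⁻ g in Set.Ioc (-(1 / 2)) (1 / 2), densityMajorant b α v g
      = b * ENNReal.ofReal |v| ^ (-((1 + α) / 2)) * J := by
    intro v
    have hm := measurable_recipSin
    unfold densityMajorant
    rw [lintegral_const_mul _ (by fun_prop)]
    congr 1
    have := lintegral_recipSin_affine (k := b ^ scaleIndex b v) (by positivity) 0 (-(1 / 2)) (1 / 2)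
    rw [hJ, ← this]
    norm_num
  simp_rw [h1]
  rw [lintegral_mul_const _ (by fun_prop), lintegral_const_mul _ (by fun_prop)]
  exact ENNReal.mul_lt_top (ENNReal.mul_lt_top (by simp)
    (lintegral_rpow_neg_abs_lt_top (by linarith) _)) hJt

/-- Periodicity replaces the Jacobian: put `y = x + h` for fixed `x`, then use that `x ↦ 2 x + h`
preserves measure on the circle for fixed `h`. -/
theorem lintegral_densityBound_eq :
    ∫⁻ x in Set.Ioc (0 : ℝ) 1, ∫⁻ y in Set.Ioc (0 : ℝ) 1, densityBound a b (x + y) (x - y)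
      = ∫⁻ h in Set.Ioc (-(1 / 2) : ℝ) (1 / 2), ∫⁻ u in Set.Ioc (-(1 / 2) : ℝ) (1 / 2),
        densityBound a b u h := by
  have hI1 : Set.Ioc (0 : ℝ) 1 = Set.Ioc (0 : ℝ) (0 + 1) := by rw [zero_add]
  have hI2 : Set.Ioc (-(1 / 2) : ℝ) (1 / 2) = Set.Ioc (-(1 / 2) : ℝ) (-(1 / 2) + 1) := by
    norm_num
  have h1 : ∀ x : ℝ, ∫⁻ y in Set.Ioc (0 : ℝ) 1, densityBound a b (x + y) (x - y)
      = ∫⁻ h in Set.Ioc (-(1 / 2) : ℝ) (1 / 2), densityBound a b (2 * x + h) h := by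
    intro x
    have hper : Function.Periodic (fun y => densityBound a b (x + y) (x - y)) 1 := fun y => by
      dsimp only
      rw [← add_assoc, densityBound_add_one_left, ← densityBound_add_one_right,
        show x - (y + 1) + 1 = x - y by ring]
    have hm : Measurable fun y => densityBound a b (x + y) (x - y) := by fun_prop
    rw [hI1, hI2, ← lintegral_periodic_affine hper hm one_ne_zero x (-(1 / 2)) 0]
    refine lintegral_congr fun h => ?_
    rw [← densityBound_neg_right]
    congr 1 <;> push_cast <;> ring
  have h3 : ∀ h : ℝ, ∫⁻ x in Set.Ioc (0 : ℝ) 1, densityBound a b (2 * x + h) h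
      = ∫⁻ u in Set.Ioc (-(1 / 2) : ℝ) (1 / 2), densityBound a b u h := by
    intro h
    have hper : Function.Periodic (fun u => densityBound a b u h) 1 := fun y =>
      densityBound_add_one_left _ _
    have hm : Measurable fun u => densityBound a b u h := by fun_prop
    rw [hI1, hI2, ← lintegral_periodic_affine hper hm two_ne_zero h 0 (-(1 / 2))]
    simp only [Nat.cast_ofNat]
  simp_rw [h1]
  rw [lintegral_lintegral_swap]
  · simp_rw [h3]
  · exact (((measurable_fst.const_mul 2).add measurable_snd).densityBound
      measurable_snd).aemeasurable

theorem lintegral_densityBound_lt_top (hb : 1 < b) (hα0 : 0 < α) (hα1 : α < 1)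
    (ha : (b : ℝ) ^ (-α) = a) (hab : 1 < a * b) :
    ∫⁻ x in Set.Ioc (0 : ℝ) 1, ∫⁻ y in Set.Ioc (0 : ℝ) 1, densityBound a b (x + y) (x - y) < ∞ := by
  rw [lintegral_densityBound_eq]
  have h4 := lintegral_densityMajorant_lt_top hb hα1
  have h5 : ∫⁻ h in Set.Ioc (-(1 / 2) : ℝ) (1 / 2), ∫⁻ u in Set.Ioc (-(1 / 2) : ℝ) (1 / 2),
      densityMajorant b α u h < ∞ := by
    rwa [lintegral_lintegral_swap]
    exact (measurable_snd.densityMajorant measurable_fst).aemeasurable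
  refine lt_of_le_of_lt ?_ (ENNReal.add_lt_top.2 ⟨h4, h5⟩)
  have hM : Measurable fun p : ℝ × ℝ => densityMajorant b α p.1 p.2 := by fun_prop
  rw [← lintegral_add_left hM.lintegral_prod_right']
  refine setLIntegral_mono (.add hM.lintegral_prod_right' hM.lintegral_prod_left') fun h hh => ?_
  refine le_of_le_of_eq ?_
    (lintegral_add_left (f := fun u => densityMajorant b α h u) (by fun_prop) _)
  refine setLIntegral_mono (by fun_prop) fun u hu => ?_
  have hh' : |h| ≤ 1 / 2 := abs_le.2 ⟨hh.1.le, hh.2⟩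
  have hu' : |u| ≤ 1 / 2 := abs_le.2 ⟨hu.1.le, hu.2⟩
  rcases le_total |h| |u| with hle | hle
  · rw [densityBound_comm]
    exact (densityBound_le_majorant hb hα0 ha hab hle hu').trans le_self_add
  · exact (densityBound_le_majorant hb hα0 ha hab hle hh').trans le_add_self

end densityBound

/-! ### The series with fixed coefficients: Hölder continuity and upper bound -/

section weierstrassSeries

variable {a : ℝ} {b : ℕ} {c : ℕ → ℝ}

theorem summable_mul_of_abs_le_pow (ha0 : 0 ≤ a) (ha1 : a < 1) (hc : ∀ n, |c n| ≤ a ^ n)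
    {t : ℕ → ℝ} {R : ℝ} (ht : ∀ n, |t n| ≤ R) : Summable fun n => c n * t n := by
  refine .of_norm_bounded ((summable_geometric_of_lt_one ha0 ha1).mul_right R) fun n => ?_
  rw [Real.norm_eq_abs, abs_mul]
  exact mul_le_mul (hc n) (ht n) (abs_nonneg _) (by positivity)

theorem weierstrassSeries_sub (ha0 : 0 ≤ a) (ha1 : a < 1) (hc : ∀ n, |c n| ≤ a ^ n) (x y : ℝ) :
    weierstrassSeries b c x - weierstrassSeries b c y
      = ∑' n, c n * (Real.cos (2 * Real.pi * (b : ℝ) ^ n * x)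
        - Real.cos (2 * Real.pi * (b : ℝ) ^ n * y)) := by
  rw [weierstrassSeries, weierstrassSeries, ← Summable.tsum_sub
    (summable_mul_of_abs_le_pow ha0 ha1 hc fun n => Real.abs_cos_le_one _)
    (summable_mul_of_abs_le_pow ha0 ha1 hc fun n => Real.abs_cos_le_one _)]
  simp_rw [mul_sub]

theorem weierstrassSeries_periodic : Function.Periodic (weierstrassSeries b c) 1 := by
  intro x
  refine tsum_congr fun n => ?_
  have : 2 * Real.pi * (b : ℝ) ^ n * (x + 1)
      = 2 * Real.pi * (b : ℝ) ^ n * x + (b ^ n : ℕ) * (2 * Real.pi) := by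
    push_cast
    ring
  rw [this, Real.cos_add_nat_mul_two_pi]

theorem abs_cos_sub_cos_le_rpow {β : ℝ} (hβ0 : 0 ≤ β) (hβ1 : β ≤ 1) (u v : ℝ) :
    |Real.cos u - Real.cos v| ≤ 2 * |u - v| ^ β := by
  rcases le_total |u - v| 1 with h | h
  · have h1 : |Real.cos u - Real.cos v| ≤ |u - v| := by
      simpa [Real.dist_eq] using Real.lipschitzWith_cos.dist_le_mul u v
    have h2 : |u - v| ≤ |u - v| ^ β := by
      simpa using Real.rpow_le_rpow_of_exponent_ge' (abs_nonneg _) h hβ0 hβ1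
    linarith [abs_nonneg (u - v)]
  · have h1 : |Real.cos u - Real.cos v| ≤ 2 := by
      rw [abs_le]
      constructor <;> linarith [Real.neg_one_le_cos u, Real.neg_one_le_cos v, Real.cos_le_one u,
        Real.cos_le_one v]
    linarith [Real.one_le_rpow h hβ0]

/-- Interpolating between the Lipschitz and the trivial bound for the cosine, the `n`-th term varies
by `O(aⁿ (bⁿ |x - y|) ^ β)`, a geometric series. -/
theorem weierstrassSeries_holder (ha0 : 0 ≤ a) (ha1 : a < 1) (hc : ∀ n, |c n| ≤ a ^ n) {β : ℝ}
    (hβ0 : 0 ≤ β) (hβ1 : β ≤ 1) (hβ : a * (b : ℝ) ^ β < 1) : ∃ C, ∀ x y,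
      |weierstrassSeries b c x - weierstrassSeries b c y| ≤ C * |x - y| ^ β := by
  refine ⟨∑' n : ℕ, (a * (b : ℝ) ^ β) ^ n * (2 * (2 * Real.pi) ^ β), fun x y => ?_⟩
  rw [weierstrassSeries_sub ha0 ha1 hc]
  have hs : Summable fun n : ℕ => (a * (b : ℝ) ^ β) ^ n * (2 * (2 * Real.pi) ^ β) :=
    (summable_geometric_of_lt_one (by positivity) hβ).mul_right _
  refine (Real.norm_eq_abs _).symm.trans_le
    (tsum_of_norm_bounded (hs.hasSum.mul_right (|x - y| ^ β)) fun n => ?_)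
  rw [Real.norm_eq_abs, abs_mul]
  have h1 := abs_cos_sub_cos_le_rpow hβ0 hβ1 (2 * Real.pi * (b : ℝ) ^ n * x)
    (2 * Real.pi * (b : ℝ) ^ n * y)
  have h2 : |2 * Real.pi * (b : ℝ) ^ n * x - 2 * Real.pi * (b : ℝ) ^ n * y| ^ β
      = (2 * Real.pi) ^ β * ((b : ℝ) ^ β) ^ n * |x - y| ^ β := by
    rw [← mul_sub, abs_mul, abs_of_nonneg (by positivity), Real.mul_rpow (by positivity)
      (abs_nonneg _), Real.mul_rpow (by positivity) (by positivity), ← Real.rpow_natCast,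
      ← Real.rpow_mul (by positivity), ← Real.rpow_natCast, ← Real.rpow_mul (by positivity),
      mul_comm β]
  rw [h2] at h1
  calc _ ≤ a ^ n * (2 * ((2 * Real.pi) ^ β * ((b : ℝ) ^ β) ^ n * |x - y| ^ β)) :=
        mul_le_mul (hc n) h1 (abs_nonneg _) (by positivity)
    _ = _ := by rw [mul_pow]; ring

/-- Summability needs `a b ^ β < 1`, that is `β < α` strictly, so the exponents `α - α / (k + 1)`
are used and `k` goes to infinity. -/
theorem dimH_planarGraph_weierstrassSeries_le (ha0 : 0 < a) (ha1 : a < 1) (hb : 1 < b) {α : ℝ}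
    (hα0 : 0 < α) (hα1 : α < 1) (ha : (b : ℝ) ^ (-α) = a) (hc : ∀ n, |c n| ≤ a ^ n) :
    dimH (planarGraph (weierstrassSeries b c)) ≤ ENNReal.ofReal (2 - α) := by
  have hlim : Tendsto (fun k : ℕ => ENNReal.ofReal (2 - (α - α * (1 / ((k : ℝ) + 1))))) atTop
      (𝓝 (ENNReal.ofReal (2 - (α - α * 0)))) :=
    (ENNReal.continuous_ofReal.tendsto _).comp (tendsto_const_nhds.sub (tendsto_const_nhds.sub
      (tendsto_const_nhds.mul tendsto_one_div_add_atTop_nhds_zero_nat)))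
  rw [mul_zero, sub_zero] at hlim
  refine ge_of_tendsto' hlim fun k => ?_
  have h0 : 0 < 1 / ((k : ℝ) + 1) := by positivity
  have h1 : 1 / ((k : ℝ) + 1) ≤ 1 := (div_le_one (by positivity)).2 (by simp)
  have hb1 : (1 : ℝ) < b := by exact_mod_cast hb
  obtain ⟨C, hC⟩ := weierstrassSeries_holder (b := b) ha0.le ha1 hc
    (β := α - α * (1 / ((k : ℝ) + 1))) (by nlinarith) (by nlinarith) (by
      rw [← ha, ← Real.rpow_add (by linarith)]
      exact Real.rpow_lt_one_of_one_lt_of_neg hb1 (by nlinarith))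
  exact dimH_planarGraph_le (by nlinarith) (by nlinarith) hC

end weierstrassSeries

/-! ### From one period to an arbitrary interval -/

theorem HasL2Density.mono_smul {μ ν : Measure ℝ} [IsFiniteMeasure μ] (hν : HasL2Density ν) (N : ℕ)
    (hμ : μ ≤ N • ν) : HasL2Density μ := by
  obtain ⟨ρ, hρ0, hρ, rfl⟩ := hν
  have hac : μ ≪ volume :=
    (Measure.absolutelyContinuous_of_le hμ).trans
      ((withDensity_absolutelyContinuous _ _).smul_left N)
  have hwd := Measure.withDensity_rnDeriv_eq μ volume hac
  have hle : ∀ᵐ x, μ.rnDeriv volume x ≤ N * ENNReal.ofReal (ρ x) := by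
    refine ae_le_of_forall_setLIntegral_le_of_sigmaFinite₀
      (Measure.measurable_rnDeriv _ _).aemeasurable fun s hs _ => ?_
    refine (Measure.setLIntegral_rnDeriv_le s).trans ((hμ s).trans (le_of_eq ?_))
    rw [Measure.smul_apply, withDensity_apply _ hs,
      lintegral_const_mul'' _ hρ.1.aemeasurable.ennreal_ofReal.restrict, nsmul_eq_mul]
  refine ⟨fun x => (μ.rnDeriv volume x).toReal, fun _ => ENNReal.toReal_nonneg, ?_, ?_⟩
  · refine hρ.of_le_mul (c := N)
      (Measure.measurable_rnDeriv _ _).ennreal_toReal.aestronglyMeasurable ?_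
    filter_upwards [hle] with x hx
    rw [Real.norm_of_nonneg ENNReal.toReal_nonneg, Real.norm_of_nonneg (hρ0 x)]
    have := ENNReal.toReal_mono (ENNReal.mul_ne_top (by simp) ENNReal.ofReal_ne_top) hx
    rwa [ENNReal.toReal_mul, ENNReal.toReal_natCast, ENNReal.toReal_ofReal (hρ0 x)] at this
  · nth_rw 1 [← hwd]
    refine withDensity_congr_ae ?_
    filter_upwards [Measure.rnDeriv_lt_top μ volume] with x hx
    rw [ENNReal.ofReal_toReal hx.ne]

theorem lintegral_Ioc_zero_nat_of_periodic {g : ℝ → ℝ≥0∞} (hg : Function.Periodic g 1)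
    (hm : Measurable g) (N : ℕ) :
    ∫⁻ x in Set.Ioc 0 (N : ℝ), g x = N * ∫⁻ x in Set.Ioc 0 1, g x := by
  induction N with
  | zero => simp
  | succ N ih =>
    have h1 := lintegral_periodic_affine hg hm one_ne_zero 0 N 0
    simp only [Nat.cast_one, one_mul, add_zero, zero_add] at h1
    rw [Nat.cast_succ, ← Set.Ioc_union_Ioc_eq_Ioc N.cast_nonneg (by linarith),
      lintegral_union measurableSet_Ioc (Set.Ioc_disjoint_Ioc_of_le le_rfl), ih, h1,
      Nat.cast_succ, add_mul, one_mul]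

theorem occupationMeasure_le_nsmul {f : ℝ → ℝ} (hf : Measurable f) (hper : Function.Periodic f 1)
    (T : ℝ) : occupationMeasure f T ≤ ⌈T⌉₊ • occupationMeasure f 1 := by
  refine Measure.le_iff.2 fun S hS => ?_
  have hg : Function.Periodic (fun x => (f ⁻¹' S).indicator (1 : ℝ → ℝ≥0∞) x) 1 := fun x => by
    by_cases h : f x ∈ S <;> simp [Set.indicator, hper x, h]
  have h1 := lintegral_Ioc_zero_nat_of_periodic hg (measurable_one.indicator (hf hS)) ⌈T⌉₊
  rw [lintegral_indicator_one (hf hS), lintegral_indicator_one (hf hS)] at h1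
  rw [Measure.smul_apply, nsmul_eq_mul, occupationMeasure, occupationMeasure,
    Measure.map_apply hf hS, Measure.map_apply hf hS, ← restrict_Ioc_eq_restrict_Icc,
    ← restrict_Ioc_eq_restrict_Icc, ← h1]
  exact Measure.restrict_mono (Set.Ioc_subset_Ioc_right (Nat.le_ceil T)) le_rfl _

/-- The σ-algebra is left free so that this also applies to the one generated by the other
coefficients, which yields independence from `A n`. -/
theorem measurable_tsum_erase {Ω : Type*} {m : MeasurableSpace Ω} {A : ℕ → Ω → ℝ} {q : ℕ → ℝ} {n : ℕ}
    (h : ∀ k ≠ n, Measurable (A k)) :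
    Measurable fun ω => ∑' k, if k = n then 0 else A k ω * q k := by
  refine .tsum fun k => ?_
  by_cases hk : k = n
  · simp [hk]
  · simpa [hk] using (h k hk).mul_const (q k)

/-! ### The random series: increments and occupation measure -/

section randomSeries

variable {Ω : Type*} [MeasurableSpace Ω] {P : Measure Ω} {a : ℝ} {b : ℕ} {A : ℕ → Ω → ℝ}

theorem measurable_weierstrassSeries (hmeas : ∀ n, Measurable (A n)) :
    Measurable fun p : Ω × ℝ => weierstrassSeries b (fun n => A n p.1) p.2 := by
  unfold weierstrassSeries
  exact .tsum fun n => by fun_prop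

theorem ae_abs_le_pow (hmeas : ∀ n, Measurable (A n))
    (hunif : ∀ n, pdf.IsUniform (A n) (Set.Ioo (-(a ^ n)) (a ^ n)) P volume) :
    ∀ᵐ ω ∂P, ∀ n, |A n ω| ≤ a ^ n := by
  refine ae_all_iff.2 fun n => ?_
  have h : ∀ᵐ x ∂P.map (A n), x ∈ Set.Ioo (-(a ^ n)) (a ^ n) := by
    rw [hunif n]
    exact ae_cond_mem measurableSet_Ioo
  filter_upwards [ae_of_ae_map (hmeas n).aemeasurable h] with ω hω
  exact abs_le.2 ⟨hω.1.le, hω.2.le⟩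

theorem map_le_of_isUniform {X : Ω → ℝ} {r : ℝ}
    (hX : pdf.IsUniform X (Set.Ioo (-r) r) P volume) :
    P.map X ≤ (ENNReal.ofReal (2 * r))⁻¹ • volume := by
  rw [hX, ProbabilityTheory.cond, Real.volume_Ioo, sub_neg_eq_add, ← two_mul]
  exact Measure.le_iff.2 fun S _ => mul_le_mul_right (Measure.restrict_le_self S) _

theorem indepFun_tsum_erase (hmeas : ∀ n, Measurable (A n)) (hindep : iIndepFun A P) (q : ℕ → ℝ)
    (n : ℕ) : IndepFun (A n) (fun ω => ∑' k, if k = n then 0 else A k ω * q k) P := by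
  rw [IndepFun_iff_Indep]
  have h := indep_iSup_of_disjoint (fun k => (hmeas k).comap_le)
    ((iIndepFun_iff_iIndep _ _ _).1 hindep) (S := {n}) (T := {n}ᶜ)
    (Set.disjoint_compl_right_iff_subset.2 le_rfl)
  refine indep_of_indep_of_le_left (indep_of_indep_of_le_right h ?_) ?_
  · refine Measurable.comap_le (measurable_tsum_erase fun k hk => ?_)
    exact (comap_measurable (A k)).mono
      (le_iSup₂_of_le (f := fun i (_ : i ∈ ({n}ᶜ : Set ℕ)) =>
        MeasurableSpace.comap (A i) inferInstance) k hk le_rfl) le_rfl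
  · exact le_iSup₂_of_le (f := fun i (_ : i ∈ ({n} : Set ℕ)) =>
      MeasurableSpace.comap (A i) inferInstance) n rfl le_rfl

/-- Isolating the `n`-th coefficient and applying anti-concentration gives one bound for each `n`.
Nonzero finite `∫ φ` lets that factor pass through the infimum. -/
theorem lintegral_increment_le [IsProbabilityMeasure P] (ha0 : 0 < a) (ha1 : a < 1)
    (hmeas : ∀ n, Measurable (A n))
    (hunif : ∀ n, pdf.IsUniform (A n) (Set.Ioo (-(a ^ n)) (a ^ n)) P volume)
    (hindep : iIndepFun A P) {φ : ℝ → ℝ≥0∞} (hφ : Measurable φ) (h0 : ∫⁻ t, φ t ≠ 0)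
    (htop : ∫⁻ t, φ t ≠ ∞) (x y : ℝ) :
    ∫⁻ ω, φ (weierstrassSeries b (fun n => A n ω) x - weierstrassSeries b (fun n => A n ω) y) ∂P
      ≤ densityBound a b (x + y) (x - y) * ∫⁻ t, φ t := by
  rw [densityBound, ENNReal.iInf_mul_of_ne h0 htop]
  refine le_iInf fun n => ?_
  set q : ℕ → ℝ := fun k => Real.cos (2 * Real.pi * (b : ℝ) ^ k * x)
    - Real.cos (2 * Real.pi * (b : ℝ) ^ k * y) with hq
  have hq2 : |q n| = 2 * |Real.sin (Real.pi * ((b : ℝ) ^ n * (x + y)))|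
      * |Real.sin (Real.pi * ((b : ℝ) ^ n * (x - y)))| := by
    simp only [hq]
    rw [Real.cos_sub_cos, abs_mul, abs_mul, abs_neg, abs_two]
    congr 4 <;> ring
  have hpow : 0 < a ^ n := pow_pos ha0 n
  have hconst : (ENNReal.ofReal (4 * a ^ n))⁻¹ * recipSin ((b : ℝ) ^ n * (x + y))
      * recipSin ((b : ℝ) ^ n * (x - y))
      = (ENNReal.ofReal (2 * a ^ n))⁻¹ * (ENNReal.ofReal |q n|)⁻¹ := by
    rw [recipSin, recipSin, ← ENNReal.mul_inv (.inr ENNReal.ofReal_ne_top)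
      (.inl ENNReal.ofReal_ne_top), ← ENNReal.ofReal_mul (by positivity),
      ← ENNReal.mul_inv (.inr ENNReal.ofReal_ne_top) (.inl ENNReal.ofReal_ne_top),
      ← ENNReal.ofReal_mul (by positivity),
      ← ENNReal.mul_inv (.inr ENNReal.ofReal_ne_top) (.inl ENNReal.ofReal_ne_top),
      ← ENNReal.ofReal_mul (by positivity), hq2]
    ring_nf
  rw [hconst]
  -- When `q n = 0` the coefficient gives no smoothing, and the corresponding bound is `∞` because
  -- `∫ φ ≠ 0`.
  rcases eq_or_ne (q n) 0 with hqn | hqn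
  · rw [hqn, abs_zero, ENNReal.ofReal_zero, ENNReal.inv_zero,
      ENNReal.mul_top (ENNReal.inv_ne_zero.2 ENNReal.ofReal_ne_top), ENNReal.top_mul h0]
    exact le_top
  refine le_of_eq_of_le (lintegral_congr_ae ?_) (lintegral_comp_mul_add_le (hmeas n)
    (measurable_tsum_erase fun k _ => hmeas k) (indepFun_tsum_erase hmeas hindep q n)
    (map_le_of_isUniform (hunif n)) hqn hφ)
  filter_upwards [ae_abs_le_pow hmeas hunif] with ω hω
  rw [weierstrassSeries_sub ha0.le ha1 hω]
  have hs : Summable fun k => A k ω * q k := summable_mul_of_abs_le_pow ha0.le ha1 hω (R := 2)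
    fun k => (abs_cos_sub_cos_le_rpow le_rfl zero_le_one _ _).trans (by simp)
  rw [hs.tsum_eq_add_tsum_ite n, mul_comm (q n)]

theorem lintegral_lintegral_lintegral_swap [SFinite P] {μ ν : Measure ℝ} [SFinite μ] [SFinite ν]
    {F : Ω → ℝ → ℝ → ℝ≥0∞} (hF : Measurable fun p : Ω × ℝ × ℝ => F p.1 p.2.1 p.2.2) :
    ∫⁻ ω, ∫⁻ x, ∫⁻ y, F ω x y ∂ν ∂μ ∂P = ∫⁻ x, ∫⁻ y, ∫⁻ ω, F ω x y ∂P ∂ν ∂μ := by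
  have h1 : Measurable fun p : (Ω × ℝ) × ℝ => F p.1.1 p.1.2 p.2 :=
    hF.comp (by fun_prop : Measurable fun p : (Ω × ℝ) × ℝ => (p.1.1, p.1.2, p.2))
  rw [lintegral_lintegral_swap h1.lintegral_prod_right'.aemeasurable]
  refine lintegral_congr fun x => lintegral_lintegral_swap ?_
  exact (hF.comp (by fun_prop : Measurable fun p : Ω × ℝ => (p.1, x, p.2))).aemeasurable

theorem lintegral_measure_closedBall_div_map {f : ℝ → ℝ} (hf : Measurable f) (κ : Measure ℝ)
    [IsFiniteMeasure κ] (r : ℝ) :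
    ∫⁻ t, κ.map f (Metric.closedBall t r) / volume (Metric.closedBall t r) ∂κ.map f
      ≤ ∫⁻ x, (∫⁻ y, (Metric.closedBall 0 r).indicator 1 (f x - f y) ∂κ)
        / ENNReal.ofReal (2 * r) ∂κ := by
  refine (lintegral_map_le _ _).trans (lintegral_mono fun x => ?_)
  simp only [Real.volume_closedBall]
  refine ENNReal.div_le_div_right (le_of_eq ?_) _
  rw [Measure.map_apply hf Metric.isClosed_closedBall.measurableSet,
    ← lintegral_indicator_one (hf Metric.isClosed_closedBall.measurableSet)]
  refine lintegral_congr fun y => ?_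
  have : y ∈ f ⁻¹' Metric.closedBall (f x) r ↔ f x - f y ∈ Metric.closedBall 0 r := by
    rw [Set.mem_preimage, Metric.mem_closedBall', mem_closedBall_zero_iff, Real.dist_eq,
      Real.norm_eq_abs]
  by_cases h : f x - f y ∈ Metric.closedBall 0 r
  · rw [Set.indicator_of_mem h, Set.indicator_of_mem (this.2 h), Pi.one_apply, Pi.one_apply]
  · rw [Set.indicator_of_notMem h, Set.indicator_of_notMem (mt this.1 h)]

theorem ae_hasL2Density_occupationMeasure_one [IsProbabilityMeasure P] (ha0 : 0 < a) (ha1 : a < 1)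
    (hb : 1 < b) (hab : 1 < a * b) {α : ℝ} (hα0 : 0 < α) (hα1 : α < 1) (ha : (b : ℝ) ^ (-α) = a)
    (hmeas : ∀ n, Measurable (A n))
    (hunif : ∀ n, pdf.IsUniform (A n) (Set.Ioo (-(a ^ n)) (a ^ n)) P volume)
    (hindep : iIndepFun A P) :
    ∀ᵐ ω ∂P, HasL2Density (occupationMeasure (weierstrassSeries b fun n => A n ω) 1) := by
  set W : Ω → ℝ → ℝ := fun ω => weierstrassSeries b fun n => A n ω with hW
  have hWm : Measurable fun p : Ω × ℝ => W p.1 p.2 := measurable_weierstrassSeries hmeas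
  set r : ℕ → ℝ := fun n => 1 / ((n : ℝ) + 1) with hr
  have hr0 : ∀ n, 0 < r n := fun n => by positivity
  have hrt : Tendsto r atTop (𝓝[>] 0) := tendsto_nhdsWithin_iff.2
    ⟨tendsto_one_div_add_atTop_nhds_zero_nat, Eventually.of_forall hr0⟩
  set κ : Measure ℝ := volume.restrict (Set.Icc 0 1) with hκ
  set F : ℕ → Ω → ℝ → ℝ → ℝ≥0∞ := fun n ω x y =>
    (Metric.closedBall 0 (r n)).indicator 1 (W ω x - W ω y) with hF
  have hFm : ∀ n, Measurable fun p : Ω × ℝ × ℝ => F n p.1 p.2.1 p.2.2 := fun n =>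
    (measurable_one.indicator Metric.isClosed_closedBall.measurableSet).comp
      ((hWm.comp (by fun_prop : Measurable fun p : Ω × ℝ × ℝ => (p.1, p.2.1))).sub
        (hWm.comp (by fun_prop : Measurable fun p : Ω × ℝ × ℝ => (p.1, p.2.2))))
  have hFm1 : ∀ n, Measurable fun p : Ω × ℝ => ∫⁻ y, F n p.1 p.2 y ∂κ := fun n =>
    Measurable.lintegral_prod_right' (f := fun p : (Ω × ℝ) × ℝ => F n p.1.1 p.1.2 p.2)
      ((hFm n).comp (by fun_prop : Measurable fun p : (Ω × ℝ) × ℝ => (p.1.1, p.1.2, p.2)))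
  set Q : ℕ → Ω → ℝ≥0∞ := fun n ω => ∫⁻ x, (∫⁻ y, F n ω x y ∂κ) / ENNReal.ofReal (2 * r n) ∂κ
    with hQ
  have hQm : ∀ n, Measurable (Q n) := fun n => ((hFm1 n).div_const _).lintegral_prod_right'
  have hvol : ∀ n, ∫⁻ t, (Metric.closedBall (0 : ℝ) (r n)).indicator (1 : ℝ → ℝ≥0∞) t
      = ENNReal.ofReal (2 * r n) := fun n => by
    rw [lintegral_indicator_one Metric.isClosed_closedBall.measurableSet, Real.volume_closedBall]
  have hK := lintegral_densityBound_lt_top hb hα0 hα1 ha hab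
  rw [restrict_Ioc_eq_restrict_Icc, ← hκ] at hK
  have hne : ∀ n, ENNReal.ofReal (2 * r n) ≠ 0 := fun n => by simpa using hr0 n
  -- The indicator of the ball has integral `2 r n`, which cancels the normalisation and makes the
  -- bound uniform in `n`.
  have hQle : ∀ n, ∫⁻ ω, Q n ω ∂P ≤ ∫⁻ x, ∫⁻ y, densityBound a b (x + y) (x - y) ∂κ ∂κ := by
    intro n
    have h1 : ∀ ω, Q n ω = (∫⁻ x, ∫⁻ y, F n ω x y ∂κ ∂κ) * (ENNReal.ofReal (2 * r n))⁻¹ := by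
      intro ω
      simp only [hQ, div_eq_mul_inv]
      rw [lintegral_mul_const]
      exact (hFm1 n).comp (by fun_prop : Measurable fun x : ℝ => (ω, x))
    simp_rw [h1]
    rw [lintegral_mul_const _ (hFm1 n).lintegral_prod_right',
      lintegral_lintegral_lintegral_swap (hFm n), ← div_eq_mul_inv,
      ENNReal.div_le_iff (hne n) ENNReal.ofReal_ne_top, ← lintegral_mul_const']
    · refine lintegral_mono fun x => ?_
      rw [← lintegral_mul_const' _ _ ENNReal.ofReal_ne_top]
      refine lintegral_mono fun y => ?_
      rw [← hvol n]
      exact lintegral_increment_le ha0 ha1 hmeas hunif hindep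
        (measurable_one.indicator Metric.isClosed_closedBall.measurableSet)
        (by rw [hvol]; exact hne n) (by rw [hvol]; exact ENNReal.ofReal_ne_top) x y
    · exact ENNReal.ofReal_ne_top
  have hliminf : ∫⁻ ω, liminf (fun n => Q n ω) atTop ∂P < ∞ := by
    refine (lintegral_liminf_le hQm).trans_lt (lt_of_le_of_lt ?_ hK)
    refine liminf_le_of_le (by isBoundedDefault) fun c hc => ?_
    obtain ⟨n, hn⟩ := hc.exists
    exact hn.trans (hQle n)
  filter_upwards [ae_lt_top (.liminf hQm) hliminf.ne] with ω hω
  have hWω : Measurable (W ω) := hWm.comp (by fun_prop : Measurable fun x : ℝ => (ω, x))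
  have : IsFiniteMeasure (occupationMeasure (W ω) 1) := by
    unfold occupationMeasure
    infer_instance
  refine hasL2Density_of_liminf_lt_top _ hrt (lt_of_le_of_lt ?_ hω)
  exact liminf_le_liminf (Eventually.of_forall fun n =>
    lintegral_measure_closedBall_div_map hWω κ (r n))

end randomSeries

/-! ### Energy of the random graph and lower bound -/

theorem lintegral_rpow_neg_add_abs {s h : ℝ} (hh : h ≠ 0) :
    ∫⁻ t : ℝ, ENNReal.ofReal (|h| + |t|) ^ (-s)
      = ENNReal.ofReal |h| ^ (1 - s) * ∫⁻ t : ℝ, ENNReal.ofReal (1 + |t|) ^ (-s) := by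
  have hpos : 0 < |h| := abs_pos.2 hh
  have h1 : ∫⁻ t : ℝ, ENNReal.ofReal (|h| + |(|h| * t)|) ^ (-s)
      = ENNReal.ofReal |h|⁻¹ * ∫⁻ t : ℝ, ENNReal.ofReal (|h| + |t|) ^ (-s) := by
    have := lintegral_map (μ := volume) (f := fun t : ℝ => ENNReal.ofReal (|h| + |t|) ^ (-s))
      (g := fun t : ℝ => |h| * t) (by fun_prop) (by fun_prop)
    rw [← this, Real.map_volume_mul_left hpos.ne', lintegral_smul_measure, smul_eq_mul, abs_inv,
      abs_abs]
  have h2 : ∀ t : ℝ, ENNReal.ofReal (|h| + |(|h| * t)|) ^ (-s)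
      = ENNReal.ofReal |h| ^ (-s) * ENNReal.ofReal (1 + |t|) ^ (-s) := by
    intro t
    rw [← ENNReal.mul_rpow_of_ne_top ENNReal.ofReal_ne_top ENNReal.ofReal_ne_top,
      ← ENNReal.ofReal_mul hpos.le, abs_mul, abs_abs]
    ring_nf
  simp_rw [h2] at h1
  rw [lintegral_const_mul _ (by fun_prop)] at h1
  have h3 : ENNReal.ofReal |h| * ENNReal.ofReal |h|⁻¹ = 1 := by
    rw [← ENNReal.ofReal_mul hpos.le, mul_inv_cancel₀ hpos.ne', ENNReal.ofReal_one]
  have h4 : ENNReal.ofReal |h| ^ (1 - s) = ENNReal.ofReal |h| * ENNReal.ofReal |h| ^ (-s) := by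
    rw [sub_eq_add_neg, ENNReal.rpow_add _ _ (by simpa using hh) ENNReal.ofReal_ne_top,
      ENNReal.rpow_one]
  rw [h4, mul_assoc, h1, ← mul_assoc, h3, one_mul]

theorem lintegral_rpow_neg_one_add_abs_lt_top {s : ℝ} (hs : 1 < s) :
    ∫⁻ t : ℝ, ENNReal.ofReal (1 + |t|) ^ (-s) < ∞ := by
  have h := finite_integral_one_add_norm (E := ℝ) (μ := volume) (r := s) (by simpa using hs)
  refine lt_of_eq_of_lt (lintegral_congr fun t => ?_) h
  rw [ENNReal.ofReal_rpow_of_pos (by positivity), Real.norm_eq_abs]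

theorem lintegral_rpow_neg_one_add_abs_ne_zero (s : ℝ) :
    ∫⁻ t : ℝ, ENNReal.ofReal (1 + |t|) ^ (-s) ≠ 0 := by
  refine ((lintegral_pos_iff_support (by fun_prop)).2 ?_).ne'
  have : Function.support (fun t : ℝ => ENNReal.ofReal (1 + |t|) ^ (-s)) = Set.univ := by
    refine Set.eq_univ_of_forall fun t => ?_
    have h1 : (0 : ℝ) < 1 + |t| := by positivity
    rw [Function.mem_support, ENNReal.ofReal_rpow_of_pos h1]
    simpa using Real.rpow_pos_of_pos h1 _
  rw [this]
  simp

theorem edist_graph_rpow_neg_le {s : ℝ} (hs : 0 ≤ s) (f : ℝ → ℝ) (x y : ℝ) :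
    edist (!₂[x, f x] : EuclideanSpace ℝ (Fin 2)) !₂[y, f y] ^ (-s)
      ≤ ENNReal.ofReal 2 ^ s * ENNReal.ofReal (|x - y| + |f x - f y|) ^ (-s) := by
  have h1 : ENNReal.ofReal (|x - y| + |f x - f y|)
      ≤ ENNReal.ofReal 2 * edist (!₂[x, f x] : EuclideanSpace ℝ (Fin 2)) !₂[y, f y] := by
    rw [edist_dist, ← ENNReal.ofReal_mul zero_le_two]
    refine ENNReal.ofReal_le_ofReal ?_
    rw [EuclideanSpace.dist_eq, Fin.sum_univ_two]
    simp only [Real.dist_eq, Matrix.cons_val_zero, Matrix.cons_val_one]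
    have e1 : |x - y| ≤ √(|x - y| ^ 2 + |f x - f y| ^ 2) := Real.le_sqrt_of_sq_le (by nlinarith)
    have e2 : |f x - f y| ≤ √(|x - y| ^ 2 + |f x - f y| ^ 2) :=
      Real.le_sqrt_of_sq_le (by nlinarith)
    linarith
  rw [ENNReal.rpow_neg, ENNReal.rpow_neg]
  refine ENNReal.inv_le_iff_inv_le.2 ?_
  rw [ENNReal.mul_inv (.inl (by simp)) (.inl (by simp)), inv_inv, mul_comm, ← div_eq_mul_inv]
  refine ENNReal.div_le_of_le_mul' ?_
  rw [← ENNReal.mul_rpow_of_nonneg _ _ hs]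
  exact ENNReal.rpow_le_rpow h1 hs

section randomSeries

variable {Ω : Type*} [MeasurableSpace Ω] {P : Measure Ω} {a : ℝ} {b : ℕ} {A : ℕ → Ω → ℝ}

/-- Interpolates the deterministic bound `|h| ^ (-s)` (weight `θ`) with the density bound, of order
`|h| ^ (1 - s - α)` times `recipSin` (weight `1 - θ`). Any `θ > 0` makes the power of `recipSin`
integrable. -/
theorem lintegral_increment_rpow_neg_le [IsProbabilityMeasure P] (ha0 : 0 < a) (ha1 : a < 1)
    (hb : 1 < b) {α : ℝ} (hα0 : 0 < α) (ha : (b : ℝ) ^ (-α) = a)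
    (hmeas : ∀ n, Measurable (A n))
    (hunif : ∀ n, pdf.IsUniform (A n) (Set.Ioo (-(a ^ n)) (a ^ n)) P volume)
    (hindep : iIndepFun A P) {s θ : ℝ} (hs : 1 < s) (hθ0 : 0 ≤ θ) (hθ1 : θ < 1) {x y : ℝ}
    (hxy : |x - y| ≤ 1 / 2) :
    ∫⁻ ω, ENNReal.ofReal (|x - y| + |weierstrassSeries b (fun n => A n ω) x
      - weierstrassSeries b (fun n => A n ω) y|) ^ (-s) ∂P
      ≤ (b * ∫⁻ t : ℝ, ENNReal.ofReal (1 + |t|) ^ (-s)) ^ (1 - θ)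
        * ENNReal.ofReal |x - y| ^ (-(s * θ + (s + α - 1) * (1 - θ)))
        * recipSin ((b : ℝ) ^ scaleIndex b (x - y) * (x + y)) ^ (1 - θ) := by
  set c := ∫⁻ t : ℝ, ENNReal.ofReal (1 + |t|) ^ (-s) with hc
  have hct : c < ∞ := lintegral_rpow_neg_one_add_abs_lt_top hs
  have hc0 : c ≠ 0 := lintegral_rpow_neg_one_add_abs_ne_zero s
  have hb0 : (b : ℝ≥0∞) ≠ 0 := by positivity
  have hθ : 0 < 1 - θ := by linarith
  set h := x - y with hh
  rcases eq_or_ne h 0 with h0 | h0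
  · rw [h0, abs_zero, ENNReal.ofReal_zero, ENNReal.zero_rpow_of_neg (by nlinarith),
      ENNReal.mul_top, ENNReal.top_mul]
    · exact le_top
    · simp [ENNReal.rpow_eq_zero_iff, recipSin_ne_zero, hθ.not_gt]
    · simp [ENNReal.rpow_eq_zero_iff, hb0, hc0, hθ.not_gt]
  have hpos : 0 < |h| := abs_pos.2 h0
  have hne : ENNReal.ofReal |h| ≠ 0 := by simpa using h0
  have hscale := lintegral_rpow_neg_add_abs (s := s) h0
  have hA : ∫⁻ ω, ENNReal.ofReal (|h| + |weierstrassSeries b (fun n => A n ω) x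
      - weierstrassSeries b (fun n => A n ω) y|) ^ (-s) ∂P ≤ ENNReal.ofReal |h| ^ (-s) := by
    refine (lintegral_mono (g := fun _ => ENNReal.ofReal |h| ^ (-s)) fun ω => ?_).trans
      (by simp)
    dsimp only
    rw [ENNReal.rpow_neg, ENNReal.rpow_neg]
    refine ENNReal.inv_le_inv.2 (ENNReal.rpow_le_rpow (ENNReal.ofReal_le_ofReal ?_) (by linarith))
    linarith [abs_nonneg (weierstrassSeries b (fun n => A n ω) x
      - weierstrassSeries b (fun n => A n ω) y)]
  have hB := lintegral_increment_le (b := b) ha0 ha1 hmeas hunif hindep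
    (φ := fun t => ENNReal.ofReal (|h| + |t|) ^ (-s)) (by fun_prop)
    (by
      rw [hscale]
      exact mul_ne_zero (by simp [ENNReal.rpow_eq_zero_iff, h0]) hc0)
    (by
      rw [hscale]
      exact ENNReal.mul_ne_top (by simp [ENNReal.rpow_eq_top_iff, h0]) hct.ne) x y
  rw [hscale, ← hh, ← hc] at hB
  have hB' := hB.trans (mul_le_mul_left (densityBound_le_left hb hα0 ha (x + y) hxy) _)
  refine (ENNReal.le_rpow_mul_rpow hθ0 hθ1.le hA hB').trans (le_of_eq ?_)
  rw [ENNReal.mul_rpow_of_nonneg _ _ hθ.le, ENNReal.mul_rpow_of_nonneg _ _ hθ.le,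
    ENNReal.mul_rpow_of_nonneg _ _ hθ.le, ENNReal.mul_rpow_of_nonneg _ _ hθ.le,
    ENNReal.mul_rpow_of_nonneg _ _ hθ.le, ← ENNReal.rpow_mul, ← ENNReal.rpow_mul,
    ← ENNReal.rpow_mul]
  have e : ENNReal.ofReal |h| ^ (-(s * θ + (s + α - 1) * (1 - θ)))
      = ENNReal.ofReal |h| ^ (-s * θ) * ENNReal.ofReal |h| ^ (-α * (1 - θ))
        * ENNReal.ofReal |h| ^ ((1 - s) * (1 - θ)) := by
    rw [← ENNReal.rpow_add _ _ hne ENNReal.ofReal_ne_top,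
      ← ENNReal.rpow_add _ _ hne ENNReal.ofReal_ne_top]
    congr 1
    ring
  rw [e]
  ring

/-- With `h = x - y` fixed, `x + y = 2 x - h`. Enlarging the range of `x` to a full period makes the
`recipSin` integral independent of `h`, leaving only `|h| ^ (-γ)`. -/
theorem lintegral_rpow_mul_recipSin_lt_top (hb : 1 < b) {C : ℝ≥0∞} (hC : C ≠ ∞) {γ β : ℝ}
    (hγ : γ < 1) (hβ0 : 0 ≤ β) (hβ1 : β < 1) :
    ∫⁻ x in Set.Ioc (0 : ℝ) (1 / 2), ∫⁻ y in Set.Ioc (0 : ℝ) (1 / 2),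
      C * ENNReal.ofReal |x - y| ^ (-γ) * recipSin ((b : ℝ) ^ scaleIndex b (x - y) * (x + y)) ^ β
      < ∞ := by
  set G : ℝ → ℝ → ℝ≥0∞ := fun u h =>
    C * ENNReal.ofReal |h| ^ (-γ) * recipSin ((b : ℝ) ^ scaleIndex b h * u) ^ β with hG
  have hGm : Measurable fun p : ℝ × ℝ => G (2 * p.1 - p.2) p.2 := by
    have h1 := measurable_recipSin
    have h2 : Measurable fun p : ℝ × ℝ => (b : ℝ) ^ scaleIndex b p.2 :=
      (measurable_from_nat (f := fun n => (b : ℝ) ^ n)).comp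
        (measurable_scaleIndex.comp measurable_snd)
    simp only [hG]
    fun_prop
  set J := ∫⁻ u in Set.Ioc (-(1 / 2)) (1 / 2), recipSin u ^ β with hJ
  have hJt : J < ∞ := lintegral_recipSin_rpow_lt_top hβ0 hβ1
  have h1 : ∀ x ∈ Set.Ioc (0 : ℝ) (1 / 2), ∫⁻ y in Set.Ioc (0 : ℝ) (1 / 2), G (x + y) (x - y)
      ≤ ∫⁻ h in Set.Ioc (-(1 / 2) : ℝ) (1 / 2), G (2 * x - h) h := by
    intro x hx
    rw [← lintegral_indicator measurableSet_Ioc, ← lintegral_indicator measurableSet_Ioc,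
      ← lintegral_sub_left_eq_self
        ((Set.Ioc (-(1 / 2) : ℝ) (1 / 2)).indicator fun h => G (2 * x - h) h) x]
    refine lintegral_mono fun y => ?_
    by_cases hy : y ∈ Set.Ioc (0 : ℝ) (1 / 2)
    · have hy' : x - y ∈ Set.Ioc (-(1 / 2) : ℝ) (1 / 2) :=
        ⟨by linarith [hx.1, hy.2], by linarith [hx.2, hy.1]⟩
      rw [Set.indicator_of_mem hy, Set.indicator_of_mem hy', show 2 * x - (x - y) = x + y by ring]
    · rw [Set.indicator_of_notMem hy]
      exact zero_le
  have h2 : ∀ h : ℝ, ∫⁻ x in Set.Ioc (0 : ℝ) 1, G (2 * x - h) h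
      = C * ENNReal.ofReal |h| ^ (-γ) * J := by
    intro h
    have hm := measurable_recipSin
    simp only [hG]
    rw [lintegral_const_mul _ (by fun_prop)]
    congr 1
    have := lintegral_recipSin_affine (k := 2 * b ^ scaleIndex b h) (by positivity)
      (-((b : ℝ) ^ scaleIndex b h * h)) 0 β
    rw [zero_add] at this
    rw [hJ, ← this]
    refine lintegral_congr fun x => ?_
    congr 2
    push_cast
    ring
  calc _ ≤ ∫⁻ x in Set.Ioc (0 : ℝ) (1 / 2), ∫⁻ h in Set.Ioc (-(1 / 2) : ℝ) (1 / 2),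
        G (2 * x - h) h := setLIntegral_mono hGm.lintegral_prod_right' h1
    _ ≤ ∫⁻ x in Set.Ioc (0 : ℝ) 1, ∫⁻ h in Set.Ioc (-(1 / 2) : ℝ) (1 / 2), G (2 * x - h) h :=
        lintegral_mono_set (Set.Ioc_subset_Ioc_right (by norm_num))
    _ = ∫⁻ h in Set.Ioc (-(1 / 2) : ℝ) (1 / 2), C * ENNReal.ofReal |h| ^ (-γ) * J := by
        rw [lintegral_lintegral_swap hGm.aemeasurable]
        simp_rw [h2]
    _ < ∞ := by
        rw [lintegral_mul_const _ (by fun_prop), lintegral_const_mul _ (by fun_prop)]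
        exact ENNReal.mul_lt_top (ENNReal.mul_lt_top hC.lt_top
          (lintegral_rpow_neg_abs_lt_top hγ _)) hJt

theorem le_dimH_planarGraph_of_lintegral_lt_top {f : ℝ → ℝ} (hf : Measurable f) {s : ℝ≥0}
    (hen : ∫⁻ x in Set.Ioc (0 : ℝ) (1 / 2), ∫⁻ y in Set.Ioc (0 : ℝ) (1 / 2),
      ENNReal.ofReal (|x - y| + |f x - f y|) ^ (-(s : ℝ)) < ∞) :
    (s : ℝ≥0∞) ≤ dimH (planarGraph f) := by
  set κ : Measure ℝ := volume.restrict (Set.Ioc (0 : ℝ) (1 / 2)) with hκ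
  set g : ℝ → EuclideanSpace ℝ (Fin 2) := fun x => !₂[x, f x] with hg
  have hgm : Measurable g := by
    refine (WithLp.measurable_toLp 2 _).comp (measurable_pi_iff.2 fun i => ?_)
    fin_cases i
    · exact measurable_id
    · exact hf
  refine le_dimH_of_energy_lt_top (κ.map g) ?_ ?_ (s := s) ?_
  · rw [Ne, Measure.map_eq_zero_iff hgm.aemeasurable, hκ, Measure.restrict_eq_zero]
    simp
  · have hS : MeasurableSet {p : EuclideanSpace ℝ (Fin 2) | p 1 ≠ f (p 0)} := by
      refine (measurableSet_eq_fun ?_ (hf.comp ?_)).compl <;> fun_prop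
    refine measure_mono_null (t := {p : EuclideanSpace ℝ (Fin 2) | p 1 ≠ f (p 0)}) ?_ ?_
    · refine fun p hp hpe => hp ⟨p 0, ?_⟩
      ext i
      fin_cases i
      · rfl
      · exact hpe.symm
    · rw [Measure.map_apply hgm hS]
      simp [hg]
  · refine lt_of_le_of_lt ?_ (ENNReal.mul_lt_top (a := ENNReal.ofReal 2 ^ (s : ℝ)) ?_ hen)
    · rw [← lintegral_const_mul' _ _ (by simp)]
      refine (lintegral_map_le _ _).trans (lintegral_mono fun x => ?_)
      rw [← lintegral_const_mul' _ _ (by simp)]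
      refine (lintegral_map_le _ _).trans (lintegral_mono fun y => ?_)
      exact edist_graph_rpow_neg_le s.2 f x y
    · exact ENNReal.rpow_lt_top_of_nonneg s.2 ENNReal.ofReal_ne_top

theorem ae_le_dimH_planarGraph [IsProbabilityMeasure P] (ha0 : 0 < a) (ha1 : a < 1)
    (hb : 1 < b) {α : ℝ} (hα0 : 0 < α) (ha : (b : ℝ) ^ (-α) = a)
    (hmeas : ∀ n, Measurable (A n))
    (hunif : ∀ n, pdf.IsUniform (A n) (Set.Ioo (-(a ^ n)) (a ^ n)) P volume)
    (hindep : iIndepFun A P) {s : ℝ≥0} (hs1 : 1 < s) (hs : (s : ℝ) < 2 - α) :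
    ∀ᵐ ω ∂P, (s : ℝ≥0∞) ≤ dimH (planarGraph (weierstrassSeries b fun n => A n ω)) := by
  set W : Ω → ℝ → ℝ := fun ω => weierstrassSeries b fun n => A n ω with hW
  have hWm : Measurable fun p : Ω × ℝ => W p.1 p.2 := measurable_weierstrassSeries hmeas
  have hs1' : (1 : ℝ) < s := by exact_mod_cast hs1
  -- Half the gap: positive, yet small enough that the exponent of `|x - y|` becomes `-(1 - (2 - α -
  -- s) (1 + α) / 2)`, which stays above `-1`.
  set θ : ℝ := (2 - α - s) / 2 with hθ
  set κ : Measure ℝ := volume.restrict (Set.Ioc (0 : ℝ) (1 / 2)) with hκ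
  have hFm : Measurable fun p : Ω × ℝ × ℝ =>
      ENNReal.ofReal (|p.2.1 - p.2.2| + |W p.1 p.2.1 - W p.1 p.2.2|) ^ (-(s : ℝ)) := by
    have h1 : Measurable fun p : Ω × ℝ × ℝ => W p.1 p.2.1 :=
      hWm.comp (by fun_prop : Measurable fun p : Ω × ℝ × ℝ => (p.1, p.2.1))
    have h2 : Measurable fun p : Ω × ℝ × ℝ => W p.1 p.2.2 :=
      hWm.comp (by fun_prop : Measurable fun p : Ω × ℝ × ℝ => (p.1, p.2.2))
    fun_prop
  have hfin : ∫⁻ ω, ∫⁻ x, ∫⁻ y, ENNReal.ofReal (|x - y| + |W ω x - W ω y|) ^ (-(s : ℝ)) ∂κ ∂κ ∂P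
      < ∞ := by
    rw [lintegral_lintegral_lintegral_swap hFm]
    refine lt_of_le_of_lt ?_ (lintegral_rpow_mul_recipSin_lt_top hb
      (C := (b * ∫⁻ t : ℝ, ENNReal.ofReal (1 + |t|) ^ (-(s : ℝ))) ^ (1 - θ))
      (γ := s * θ + (s + α - 1) * (1 - θ)) (β := 1 - θ) ?_ ?_ ?_ ?_)
    · refine setLIntegral_mono' measurableSet_Ioc fun x hx =>
        setLIntegral_mono' measurableSet_Ioc fun y hy => ?_
      exact lintegral_increment_rpow_neg_le ha0 ha1 hb hα0 ha hmeas hunif hindep hs1'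
        (by simp only [hθ]; linarith) (by simp only [hθ]; linarith)
        (abs_le.2 ⟨by linarith [hx.1, hy.2], by linarith [hx.2, hy.1]⟩)
    · exact (ENNReal.rpow_lt_top_of_nonneg (by simp only [hθ]; linarith)
        (ENNReal.mul_ne_top (by simp) (lintegral_rpow_neg_one_add_abs_lt_top hs1').ne)).ne
    · have : s * θ + (s + α - 1) * (1 - θ) = 1 - (2 - α - s) * (1 - (1 - α) / 2) := by
        simp only [hθ]; ring
      rw [this]
      nlinarith
    · simp only [hθ]; linarith
    · simp only [hθ]; linarith
  have hmeasE : Measurable fun ω => ∫⁻ x, ∫⁻ y,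
      ENNReal.ofReal (|x - y| + |W ω x - W ω y|) ^ (-(s : ℝ)) ∂κ ∂κ := by
    have := hFm.comp (by fun_prop : Measurable fun p : (Ω × ℝ) × ℝ => (p.1.1, p.1.2, p.2))
    exact Measurable.lintegral_prod_right' (f := fun p : Ω × ℝ => ∫⁻ y,
      ENNReal.ofReal (|p.2 - y| + |W p.1 p.2 - W p.1 y|) ^ (-(s : ℝ)) ∂κ)
      this.lintegral_prod_right'
  filter_upwards [ae_lt_top hmeasE hfin.ne] with ω hω
  exact le_dimH_planarGraph_of_lintegral_lt_top
    (hWm.comp (by fun_prop : Measurable fun x : ℝ => (ω, x))) hω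

theorem ae_dimH_planarGraph_eq [IsProbabilityMeasure P] (ha0 : 0 < a) (ha1 : a < 1)
    (hb : 1 < b) {α : ℝ} (hα0 : 0 < α) (hα1 : α < 1) (ha : (b : ℝ) ^ (-α) = a)
    (hmeas : ∀ n, Measurable (A n))
    (hunif : ∀ n, pdf.IsUniform (A n) (Set.Ioo (-(a ^ n)) (a ^ n)) P volume)
    (hindep : iIndepFun A P) :
    ∀ᵐ ω ∂P, dimH (planarGraph (weierstrassSeries b fun n => A n ω))
      = ENNReal.ofReal (2 - α) := by
  -- The denominator `k + 2`, rather than `k + 1`, keeps `s 0` strictly above `1`, as the energy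
  -- estimate requires.
  set s : ℕ → ℝ := fun k => 2 - α - (1 - α) * (1 / ((k : ℝ) + 1 + 1)) with hsdef
  have hs : ∀ k, 1 < s k ∧ s k < 2 - α := by
    intro k
    have h0 : 0 < 1 / ((k : ℝ) + 1 + 1) := by positivity
    have h1 : 1 / ((k : ℝ) + 1 + 1) < 1 :=
      (div_lt_one (by positivity)).2 (by linarith [k.cast_nonneg (α := ℝ)])
    constructor <;> simp only [hsdef] <;> nlinarith
  have hlim : Tendsto (fun k => ENNReal.ofReal (s k)) atTop
      (𝓝 (ENNReal.ofReal (2 - α - (1 - α) * 0))) := by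
    refine (ENNReal.continuous_ofReal.tendsto _).comp (tendsto_const_nhds.sub
      (tendsto_const_nhds.mul ?_))
    have := (tendsto_add_atTop_iff_nat 1).2 (tendsto_one_div_add_atTop_nhds_zero_nat (𝕜 := ℝ))
    simpa only [Nat.cast_add, Nat.cast_one] using this
  rw [mul_zero, sub_zero] at hlim
  have hlow : ∀ᵐ ω ∂P, ∀ k, ENNReal.ofReal (s k)
      ≤ dimH (planarGraph (weierstrassSeries b fun n => A n ω)) := by
    refine ae_all_iff.2 fun k => ?_
    refine ae_le_dimH_planarGraph ha0 ha1 hb hα0 ha hmeas hunif hindep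
      (s := (s k).toNNReal) ?_ ?_
    · rw [Real.one_lt_toNNReal]
      exact (hs k).1
    · rw [Real.coe_toNNReal _ (by linarith [(hs k).1])]
      exact (hs k).2
  filter_upwards [hlow, ae_abs_le_pow hmeas hunif] with ω h1 h2
  exact le_antisymm (dimH_planarGraph_weierstrassSeries_le ha0 ha1 hb hα0 hα1 ha h2)
    (le_of_tendsto' hlim h1)

end randomSeries

/-! ### The theorem -/

theorem corollaryC {Ω : Type*} [MeasurableSpace Ω] (P : Measure Ω) [IsProbabilityMeasure P]
    (a : ℝ) (ha0 : 0 < a) (ha1 : a < 1) (b : ℕ) (hb : 1 < b) (hab : 1 < a * (b : ℝ))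
    (A : ℕ → Ω → ℝ) (hmeas : ∀ n, Measurable (A n))
    (hunif : ∀ n, pdf.IsUniform (A n) (Set.Ioo (-(a ^ n)) (a ^ n)) P volume)
    (hindep : iIndepFun A P) :
    (∀ᵐ ω ∂P, ∀ x : ℝ, Summable fun n : ℕ =>
        A n ω * Real.cos (2 * Real.pi * (b : ℝ) ^ n * x)) ∧
    (∀ᵐ ω ∂P, dimH (planarGraph (weierstrassSeries b fun n => A n ω)) =
        ENNReal.ofReal (2 + Real.log a / Real.log b)) ∧
    (∀ᵐ ω ∂P, ∀ T : ℝ, 0 < T → Function.Periodic (weierstrassSeries b fun n => A n ω) T →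
        HasL2Density (occupationMeasure (weierstrassSeries b fun n => A n ω) T)) := by
  have hb1 : (1 : ℝ) < b := by exact_mod_cast hb
  have hlogb : 0 < Real.log b := Real.log_pos hb1
  have hloga : Real.log a < 0 := Real.log_neg ha0 ha1
  -- Chosen so that `b ^ (-α) = a`; then `a < 1` means `α > 0` and `a b > 1` means `α < 1`.
  set α : ℝ := -(Real.log a / Real.log b) with hα
  have hα0 : 0 < α := neg_pos.2 (div_neg_of_neg_of_pos hloga hlogb)
  have hα1 : α < 1 := by
    have : 0 < Real.log a + Real.log b := by
      rw [← Real.log_mul ha0.ne' (by positivity)]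
      exact Real.log_pos hab
    rw [hα, ← neg_div, div_lt_one hlogb]
    linarith
  have ha : (b : ℝ) ^ (-α) = a := by
    rw [hα, neg_neg, Real.rpow_def_of_pos (by linarith), mul_div_cancel₀ _ hlogb.ne',
      Real.exp_log ha0]
  refine ⟨?_, ?_, ?_⟩
  · filter_upwards [ae_abs_le_pow hmeas hunif] with ω hω x
    exact summable_mul_of_abs_le_pow ha0.le ha1 hω fun n => Real.abs_cos_le_one _
  · have h := ae_dimH_planarGraph_eq ha0 ha1 hb hα0 hα1 ha hmeas hunif hindep
    rwa [show 2 - α = 2 + Real.log a / Real.log b by rw [hα, sub_neg_eq_add]] at h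
  · filter_upwards [ae_hasL2Density_occupationMeasure_one ha0 ha1 hb hab hα0 hα1 ha hmeas hunif
      hindep] with ω hω T _ _
    have hW : Measurable (weierstrassSeries b fun n => A n ω) :=
      (measurable_weierstrassSeries hmeas).comp (by fun_prop : Measurable fun x : ℝ => (ω, x))
    have : IsFiniteMeasure (occupationMeasure (weierstrassSeries b fun n => A n ω) T) := by
      unfold occupationMeasure
      infer_instance
    exact hω.mono_smul _ (occupationMeasure_le_nsmul hW weierstrassSeries_periodic T)
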